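/- Let $n\ge 1$ be an integer, let $M\subset\mathbb{R}^{n+1}$ be a smooth (embedded, without boundary) $n$-dimensional hypersurface, and let $a\in[0,n)$. Let $\nu_M$ denote the unit normal to $M$, defined locally up to sign; let $\nabla_T\varphi=\nabla\varphi-(\nabla\varphi\cdot\nu_M)\nu_M$ be the tangential gradient of $\varphi$ (where $\varphi$ is extended to a neighbourhood of the point in $\mathbb{R}^{n+1}$); let $H=\operatorname{div}_T\nu_M$ be the mean curvature of $M$, that is, the sum of its principal curvatures; and let $dV$ be the $n$-dimensional volume element of $M$. Let $C^1_c(M)$ be the space of $C^1$ functions on $M$ with compact support in $M$ (all of $C^1(M)$ when $M$ is compact). Then, for every $\varphi\in C^1_c(M)$, all the integrals below are finite and $$ (n-a)\int_M\frac{\varphi^2}{|x|^a}\,dV+a\int_M\left(\frac{x}{|x|}\cdot\nu_M\right)^2\frac{\varphi^2}{|x|^a}\,dV \le \left(\int_M\frac{\varphi^2}{|x|^a}\,dV\right)^{1/2} \left(\int_M\frac{4|\nabla_T\varphi|^2+|H\varphi|^2}{|x|^{a-2}}\,dV\right)^{1/2}. $$ -/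

import Mathlib

open MeasureTheory Topology
open scoped ContDiff

noncomputable section

namespace Hypersurface

/-- The ambient space `ℝ^{n+1}`, with its Euclidean norm and inner product. -/
abbrev Ambient (n : ℕ) : Type := EuclideanSpace ℝ (Fin (n + 1))

variable {n : ℕ}

/-- `M` is a smooth (`C^∞`, embedded, without boundary) hypersurface of `ℝ^{n+1}`: near each of its
points it is the zero set of a smooth function whose differential does not vanish on `M`.
`M` need be neither closed, nor connected, nor orientable. -/
def IsSmoothHypersurface (M : Set (Ambient n)) : Prop :=
  ∀ p ∈ M, ∃ (U : Set (Ambient n)) (f : Ambient n → ℝ), IsOpen U ∧ p ∈ U ∧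
    ContDiffOn ℝ ∞ f U ∧ (∀ x ∈ M ∩ U, fderiv ℝ f x ≠ 0) ∧ M ∩ U = {x ∈ U | f x = 0}

/-- `v` is one of the two unit normals to `M` at `x`: a unit vector orthogonal to all
directions tangent to `M` at `x`. -/
def IsUnitNormalAt (M : Set (Ambient n)) (x v : Ambient n) : Prop :=
  ‖v‖ = 1 ∧ ∀ w ∈ tangentConeAt ℝ M x, inner ℝ w v = 0

/-- `N` is, near `x`, a smooth field of unit normals to `M` (smoothly extended to an open
neighbourhood of `x` in the ambient space). -/
def IsLocalUnitNormalField (M : Set (Ambient n)) (x : Ambient n) (N : Ambient n → Ambient n) :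
    Prop :=
  ∃ U : Set (Ambient n), IsOpen U ∧ x ∈ U ∧ ContDiffOn ℝ ∞ N U ∧
    ∀ y ∈ M ∩ U, IsUnitNormalAt M y (N y)

/-- A smooth hypersurface has a smooth field of unit normals near each of its points. -/
theorem IsSmoothHypersurface.exists_isLocalUnitNormalField {M : Set (Ambient n)}
    (hM : IsSmoothHypersurface M) {x : Ambient n} (hx : x ∈ M) :
    ∃ N, IsLocalUnitNormalField M x N := by
  obtain ⟨U, f, hU, hxU, hf, hdf, hMU⟩ := hM x hx
  have hD : ContDiffOn ℝ ∞ (fderiv ℝ f) U := hf.fderiv_of_isOpen hU (by simp)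
  have hG : ContDiffOn ℝ ∞ (gradient f) U :=
    (InnerProductSpace.toDual ℝ (Ambient n)).symm.contDiff.comp_contDiffOn hD
  have hG0 : ∀ y, gradient f y = 0 ↔ fderiv ℝ f y = 0 := fun y => by simp [gradient]
  refine ⟨fun y => ‖gradient f y‖⁻¹ • gradient f y, U ∩ gradient f ⁻¹' {0}ᶜ,
    hG.continuousOn.isOpen_inter_preimage hU isOpen_compl_singleton, ⟨hxU, ?_⟩, ?_, ?_⟩
  · simpa [hG0] using hdf x ⟨hx, hxU⟩
  · intro y hy
    have h1 : ContDiffWithinAt ℝ ∞ (gradient f) (U ∩ gradient f ⁻¹' {0}ᶜ) y :=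
      (hG y hy.1).mono Set.inter_subset_left
    have h2 : gradient f y ≠ 0 := hy.2
    exact ((h1.norm ℝ h2).inv (norm_ne_zero_iff.mpr h2)).smul h1
  · rintro y ⟨hyM, hyU, hy0⟩
    have h2 : gradient f y ≠ 0 := hy0
    refine ⟨norm_smul_inv_norm (𝕜 := ℝ) h2, fun w hw => ?_⟩
    have hd : DifferentiableAt ℝ f y :=
      (hf.contDiffAt (hU.mem_nhds hyU)).differentiableAt (by simp)
    have h0 : HasFDerivWithinAt f (0 : Ambient n →L[ℝ] ℝ) M y := by
      refine (hasFDerivWithinAt_const (0 : ℝ) y M).congr_of_eventuallyEq ?_ ?_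
      · filter_upwards [self_mem_nhdsWithin, mem_nhdsWithin_of_mem_nhds (hU.mem_nhds hyU)]
          with z hzM hzU
        exact (hMU.subset ⟨hzM, hzU⟩).2
      · exact (hMU.subset ⟨hyM, hyU⟩).2
    have hw0 : fderiv ℝ f y w = 0 := by
      simpa using hd.hasFDerivAt.hasFDerivWithinAt.unique_on h0 hw
    rw [inner_smul_right, real_inner_comm, gradient, InnerProductSpace.toDual_symm_apply, hw0,
      mul_zero]

/-- A smooth field of unit normals to `M` near the point `x ∈ M`. Such a field is determined on
`M`, near `x`, up to a global sign. -/
def localUnitNormal (M : Set (Ambient n)) (x : Ambient n) : Ambient n → Ambient n :=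
  Classical.epsilon (IsLocalUnitNormalField M x)

/-- The unit normal `ν_M(x)` to `M` at the point `x ∈ M`, determined up to sign. -/
def unitNormal (M : Set (Ambient n)) (x : Ambient n) : Ambient n :=
  localUnitNormal M x x

/-- The partial derivative `∂_i φ(x)` of an extension of `φ|_M`, that is, the `i`-th component of
some derivative of `φ` at `x` along `M`. Only tangential combinations of
these numbers are independent of the extension. -/
def extPartialDeriv (M : Set (Ambient n)) (i : Fin (n + 1)) (φ : Ambient n → ℝ) (x : Ambient n) :
    ℝ :=
  fderivWithin ℝ φ M x (EuclideanSpace.single i 1)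

/-- The tangential derivative `δ_i φ = ∂_i φ - ν_M^i ∑_j (∂_j φ) ν_M^j`. It depends neither on the
extension of `φ|_M` nor on the sign of `ν_M`. -/
def tangentialDeriv (M : Set (Ambient n)) (i : Fin (n + 1)) (φ : Ambient n → ℝ) (x : Ambient n) :
    ℝ :=
  extPartialDeriv M i φ x -
    unitNormal M x i * ∑ j, extPartialDeriv M j φ x * unitNormal M x j

/-- The tangential gradient `∇_T φ = (δ_1 φ, …, δ_{n+1} φ)`. -/
def tangentialGradient (M : Set (Ambient n)) (φ : Ambient n → ℝ) (x : Ambient n) : Ambient n :=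
  WithLp.toLp 2 fun i => tangentialDeriv M i φ x

/-- The tangential divergence `div_T Z = ∑_i δ_i Z^i` of a vector field `Z`, not necessarily
tangent. -/
def tangentialDiv (M : Set (Ambient n)) (Z : Ambient n → Ambient n) (x : Ambient n) : ℝ :=
  ∑ i, tangentialDeriv M i (fun y => Z y i) x

/-- The mean curvature `H = div_T ν_M`, the sum of the principal curvatures, at a point `x ∈ M`.
It changes sign with the unit normal. -/
def meanCurvature (M : Set (Ambient n)) (x : Ambient n) : ℝ :=
  tangentialDiv M (localUnitNormal M x) x

/-- The volume element `dV` of an `n`-dimensional `M ⊆ ℝ^{n+1}`: the `n`-dimensional Hausdorff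
measure, normalised to be Lebesgue measure on `ℝ^n`, restricted to `M`. -/
def volumeMeasure (M : Set (Ambient n)) : Measure (Ambient n) :=
  (μHE[n] : Measure (Ambient n)).restrict M

/-- `φ ∈ C¹_c(M)`: the restriction of `φ` to `M` is of class `C¹` and has compact support in `M`.
The values of `φ` outside of `M` play no role. -/
def IsC1c (M : Set (Ambient n)) (φ : Ambient n → ℝ) : Prop :=
  ContDiffOn ℝ 1 φ M ∧ HasCompactSupport (M.domRestrict φ)

end Hypersurface

end

/-! Apply the divergence theorem `∫ div_T Z = ∫ H ν·Z` on `M` to `Z = φ² |x|^{-a} x`. Since `div_T x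
= n`, writing `c = (x/|x|)·ν`, one has `div_T Z = φ² |x|^{-a} (n - a + a c²) + 2 φ |x|^{-a} ∇_T
φ·x`. The left side of the theorem is therefore the integral of `φ |x|^{-a} (H φ ν - 2 ∇_T φ)·x`. As
`ν ⊥ ∇_T φ`, the vector in parentheses has norm `(4|∇_T φ|² + |Hφ|²)^{1/2}`; Cauchy–Schwarz
pointwise and then in `L²` concludes.

The origin may lie on `M`, so `|x|^{-a}` is replaced by `regWeight`, that is `(|x|² + ε)^{-a/2}`.
The error so created has a favourable sign (`le_tangentialDiv_add`), and dominated convergence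
removes `ε` in `hardy_inequality`. The dominating function is integrable because `a < n`.

The divergence theorem is proved by hand, without orientability. `M` is locally a graph
(`exists_graph`); the area formula turns its Hausdorff measure into `J dy`, and
`trace_fderiv_jac_smul_tangential` identifies `J (div_T Z - H ν·Z)` with the Euclidean divergence of
`J` times the tangential part of `Z`. This integrates to zero, and a partition of unity glues the
charts. The unit normal is chosen pointwise up to sign, so only expressions even in the pair `(ν,
H)` are ever used. -/

noncomputable section

namespace Hypersurface

/-! ### The area formula for injective `C¹` immersions. -/

section AreaFormula

open Module Set
open scoped ENNReal NNReal

variable {X Y Z : Type*} [MetricSpace Y] [MeasurableSpace Y] [BorelSpace Y]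
  [MetricSpace Z] [MeasurableSpace Z] [BorelSpace Z]

/-- The hypothesis forces `f` to factor through `g` on `A`, and the factor `g '' A → Y` is
`c`-Lipschitz. -/
theorem euclideanHausdorffMeasure_image_le_of_dist_le {f : X → Y} {g : X → Z} {A : Set X} {c : ℝ≥0}
    (h : ∀ x ∈ A, ∀ y ∈ A, dist (f x) (f y) ≤ c * dist (g x) (g y)) (d : ℕ) :
    (μHE[d] : Measure Y) (f '' A) ≤ (c : ℝ≥0∞) ^ d * (μHE[d] : Measure Z) (g '' A) := by
  rcases A.eq_empty_or_nonempty with rfl | ⟨x₀, hx₀⟩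
  · simp
  have : Nonempty X := ⟨x₀⟩
  set k : Z → Y := f ∘ Function.invFunOn g A
  have hmem : ∀ x ∈ A, Function.invFunOn g A (g x) ∈ A := fun x hx =>
    Function.invFunOn_mem ⟨x, hx, rfl⟩
  have heq : ∀ x ∈ A, g (Function.invFunOn g A (g x)) = g x := fun x hx =>
    Function.invFunOn_eq ⟨x, hx, rfl⟩
  have hk : LipschitzOnWith c k (g '' A) := by
    refine LipschitzOnWith.of_dist_le_mul ?_
    rintro _ ⟨x, hx, rfl⟩ _ ⟨y, hy, rfl⟩
    simpa [k, heq x hx, heq y hy] using h _ (hmem x hx) _ (hmem y hy)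
  have hkg : k '' (g '' A) = f '' A := by
    rw [Set.image_image]
    refine Set.image_congr fun x hx => ?_
    have := h _ (hmem x hx) x hx
    rw [heq x hx, dist_self, mul_zero] at this
    exact dist_le_zero.1 this
  have key := hk.hausdorffMeasure_image_le (d := d) (by positivity)
  rw [hkg, ENNReal.rpow_natCast] at key
  simp only [Measure.euclideanHausdorffMeasure_def, Measure.smul_apply, ENNReal.smul_def,
    smul_eq_mul]
  calc _ ≤ _ := mul_le_mul_right key _
    _ = _ := by ring

/-- By second countability, countably many of the neighbourhoods cover `X`; make them disjoint and
sum. -/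
theorem measure_le_of_locally_le {X : Type*} [TopologicalSpace X] [SecondCountableTopology X]
    [MeasurableSpace X] [OpensMeasurableSpace X] {μ ν : Measure X}
    (h : ∀ x, ∃ U ∈ 𝓝 x, ∀ A ⊆ U, MeasurableSet A → μ A ≤ ν A) : μ ≤ ν := by
  choose U hU hle using h
  obtain ⟨t, htc, ht⟩ := TopologicalSpace.countable_cover_nhds
    (f := fun x => interior (U x)) (fun x => interior_mem_nhds.2 (hU x))
  rcases t.eq_empty_or_nonempty with rfl | hne
  · have : IsEmpty X := by
      rw [← Set.univ_eq_empty_iff, ← ht]; simp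
    intro s
    simp [Set.eq_empty_of_isEmpty s]
  obtain ⟨x, hx⟩ := htc.exists_eq_range hne
  set D : ℕ → Set X := disjointed fun k => interior (U (x k))
  have hDm : ∀ k, MeasurableSet (D k) :=
    MeasurableSet.disjointed fun k => isOpen_interior.measurableSet
  have hDU : ∀ k, D k ⊆ U (x k) := fun k => (disjointed_subset _ k).trans interior_subset
  have hD : ⋃ k, D k = univ := by
    rw [iUnion_disjointed, ← ht, hx, biUnion_range]
  have key : ∀ κ : Measure X, ∀ s, MeasurableSet s → κ s = ∑' k, κ (s ∩ D k) := by
    intro κ s hs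
    rw [← measure_iUnion, ← inter_iUnion, hD, inter_univ]
    · exact fun i j hij => (disjoint_disjointed _ hij).mono inter_subset_right inter_subset_right
    · exact fun k => hs.inter (hDm k)
  refine Measure.le_iff.2 fun s hs => ?_
  rw [key μ s hs, key ν s hs]
  exact ENNReal.tsum_le_tsum fun k =>
    hle (x k) _ (inter_subset_right.trans (hDU k)) (hs.inter (hDm k))

variable {V E : Type*} [NormedAddCommGroup V] [InnerProductSpace ℝ V] [FiniteDimensional ℝ V]
  [NormedAddCommGroup E] [InnerProductSpace ℝ E]

theorem continuous_normDet [CompleteSpace E] :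
    Continuous fun L : V →L[ℝ] E => (L : V →ₗ[ℝ] E).normDet := by
  have h : (fun L : V →L[ℝ] E => (L : V →ₗ[ℝ] E).normDet) =
      fun L : V →L[ℝ] E => √((L.adjoint ∘L L).det) := by
    ext L
    have := L.normDet_sq
    simp only [RCLike.ofReal_real_eq_id, id] at this
    rw [← this, Real.sqrt_sq (LinearMap.normDet_nonneg _)]
  rw [h]
  refine Real.continuous_sqrt.comp (ContinuousLinearMap.continuous_det.comp ?_)
  exact (ContinuousLinearMap.adjoint.continuous).clm_comp continuous_id

/-- Strict differentiability bounds the linearization error by a small multiple of `‖x - y‖`, and an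
injective derivative `L` bounds `‖x - y‖` by `K ‖L (x - y)‖`. -/
theorem exists_nhds_bilipschitz_fderiv {ψ : V → E} (hψ : ContDiff ℝ 1 ψ) (y₀ : V)
    (hinj : Function.Injective (fderiv ℝ ψ y₀)) {c : ℝ} (hc : 1 < c) :
    ∃ U ∈ 𝓝 y₀, ∀ x ∈ U, ∀ y ∈ U,
      dist (ψ x) (ψ y) ≤ c * dist (fderiv ℝ ψ y₀ x) (fderiv ℝ ψ y₀ y) ∧
      dist (fderiv ℝ ψ y₀ x) (fderiv ℝ ψ y₀ y) ≤ c * dist (ψ x) (ψ y) := by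
  set L := fderiv ℝ ψ y₀
  obtain ⟨K, hK, hL⟩ := (LinearMap.injective_iff_antilipschitz (L : V →ₗ[ℝ] E)).1 hinj
  have hLK : ∀ v, ‖v‖ ≤ K * ‖L v‖ := fun v => by
    simpa using hL.le_mul_dist v 0
  have hstrict : HasStrictFDerivAt ψ L y₀ :=
    hψ.contDiffAt.hasStrictFDerivAt (by simp)
  have hδ : 0 < 1 - c⁻¹ := by
    have := inv_lt_one_of_one_lt₀ hc; linarith
  have hK' : (0 : ℝ) < K := by exact_mod_cast hK
  -- With this constant the error is at most `(1 - c⁻¹) ‖L (x - y)‖`. The lower bound `c⁻¹ ‖L (x -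
  -- y)‖` is then immediate, and the upper one needs `2 - c⁻¹ ≤ c`.
  obtain ⟨U, hU, hUψ⟩ := hstrict.approximates_deriv_on_nhds
    (c := Real.toNNReal ((1 - c⁻¹) / K)) (Or.inr (by simp only [Real.toNNReal_pos]; positivity))
  refine ⟨U, hU, fun x hx y hy => ?_⟩
  have h1 := hUψ x hx y hy
  rw [Real.coe_toNNReal _ (by positivity)] at h1
  have h2 : ‖ψ x - ψ y - L (x - y)‖ ≤ (1 - c⁻¹) * ‖L (x - y)‖ := by
    refine h1.trans ?_
    calc (1 - c⁻¹) / K * ‖x - y‖ ≤ (1 - c⁻¹) / K * (K * ‖L (x - y)‖) := by gcongr; exact hLK _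
      _ = _ := by field_simp
  rw [dist_eq_norm, dist_eq_norm, ← map_sub]
  set a := ψ x - ψ y
  set b := L (x - y)
  have hcc : c⁻¹ * c = 1 := inv_mul_cancel₀ (by positivity)
  have hc2 : 2 - c⁻¹ ≤ c := by nlinarith [mul_pos hδ hδ, inv_pos.2 (zero_lt_one.trans hc)]
  constructor
  · have : ‖a‖ ≤ ‖a - b‖ + ‖b‖ := by simpa using norm_add_le (a - b) b
    nlinarith [norm_nonneg b]
  · have : ‖b‖ ≤ ‖a - b‖ + ‖a‖ := by
      have := norm_sub_le a (a - b); simp at this; linarith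
    have h3 : c⁻¹ * ‖b‖ ≤ ‖a‖ := by linarith
    calc ‖b‖ = c * (c⁻¹ * ‖b‖) := by field_simp
      _ ≤ c * ‖a‖ := by gcongr

variable [MeasurableSpace V] [BorelSpace V] [FiniteDimensional ℝ E] [MeasurableSpace E]
  [BorelSpace E]

/-- The area formula for an injective immersion of class `C¹`. -/
theorem comap_euclideanHausdorffMeasure_eq_withDensity {ψ : V → E} (hψ : ContDiff ℝ 1 ψ)
    (hinj : Function.Injective ψ) (himm : ∀ y, Function.Injective (fderiv ℝ ψ y)) :
    (μHE[finrank ℝ V] : Measure E).comap ψ = (volume : Measure V).withDensity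
      fun y => ENNReal.ofReal (fderiv ℝ ψ y : V →ₗ[ℝ] E).normDet := by
  have hemb : MeasurableEmbedding ψ := hψ.continuous.measurableEmbedding hinj
  set J : V → ℝ := fun y => (fderiv ℝ ψ y : V →ₗ[ℝ] E).normDet
  have hJ : Continuous J := continuous_normDet.comp (hψ.continuous_fderiv (by simp))
  have hJpos : ∀ y, 0 < J y := fun y =>
    lt_of_le_of_ne (LinearMap.normDet_nonneg _) (Ne.symm (by
      rw [Ne, LinearMap.normDet_eq_zero_iff_ker_ne_bot, not_not, LinearMap.ker_eq_bot]
      exact himm y))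
  set d := finrank ℝ V
  -- Of the `d + 1` factors `c`, `d` come from comparing `ψ` with its derivative at `y₀` and one
  -- from the oscillation of `J` near `y₀`.
  have key : ∀ c : ℝ≥0, 1 < c → ∀ y₀ : V, ∃ U ∈ 𝓝 y₀, ∀ A ⊆ U, MeasurableSet A →
      (μHE[d] : Measure E) (ψ '' A) ≤
        (c : ℝ≥0∞) ^ (d + 1) * ∫⁻ y in A, ENNReal.ofReal (J y) ∧
      ∫⁻ y in A, ENNReal.ofReal (J y) ≤
        (c : ℝ≥0∞) ^ (d + 1) * (μHE[d] : Measure E) (ψ '' A) := by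
    intro c hc y₀
    have hc' : (1 : ℝ) < c := by exact_mod_cast hc
    obtain ⟨U, hU, hUψ⟩ := exists_nhds_bilipschitz_fderiv hψ y₀ (himm y₀) hc'
    have hc0 : (0 : ℝ) < c := by positivity
    have h1 : ∀ᶠ y in 𝓝 y₀, J y < c * J y₀ :=
      hJ.continuousAt.eventually_lt continuousAt_const (by nlinarith [hJpos y₀])
    have h2 : ∀ᶠ y in 𝓝 y₀, J y₀ < c * J y :=
      continuousAt_const.eventually_lt (continuousAt_const.mul hJ.continuousAt)
        (by nlinarith [hJpos y₀])
    refine ⟨_, Filter.inter_mem hU (h1.and h2), fun A hA hAm => ?_⟩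
    have hvol := LinearMap.euclideanHausdorffMeasure_image_eq_normDet_mul_volume
      (fderiv ℝ ψ y₀ : V →ₗ[ℝ] E) A
    have hLA : (μHE[d] : Measure E) (fderiv ℝ ψ y₀ '' A) =
      ENNReal.ofReal (J y₀) * volume A := hvol
    have e1 := euclideanHausdorffMeasure_image_le_of_dist_le (f := ψ) (g := fderiv ℝ ψ y₀) (A := A)
      (c := c) (fun x hx y hy => (hUψ x (hA hx).1 y (hA hy).1).1) d
    have e2 := euclideanHausdorffMeasure_image_le_of_dist_le (f := fderiv ℝ ψ y₀) (g := ψ) (A := A)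
      (c := c) (fun x hx y hy => (hUψ x (hA hx).1 y (hA hy).1).2) d
    have i1 : ENNReal.ofReal (J y₀) * volume A ≤ c * ∫⁻ y in A, ENNReal.ofReal (J y) := by
      rw [← setLIntegral_const, ← lintegral_const_mul _ (by fun_prop)]
      refine setLIntegral_mono (by fun_prop) fun y hy => ?_
      rw [← ENNReal.ofReal_coe_nnreal, ← ENNReal.ofReal_mul (by positivity)]
      exact ENNReal.ofReal_le_ofReal (hA hy).2.2.le
    have i2 : ∫⁻ y in A, ENNReal.ofReal (J y) ≤ c * (ENNReal.ofReal (J y₀) * volume A) := by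
      rw [← mul_assoc, ← setLIntegral_const]
      refine setLIntegral_mono (by fun_prop) fun y hy => ?_
      rw [← ENNReal.ofReal_coe_nnreal, ← ENNReal.ofReal_mul (by positivity)]
      exact ENNReal.ofReal_le_ofReal (hA hy).2.1.le
    rw [hLA] at e1 e2
    constructor
    · calc _ ≤ _ := e1
        _ ≤ (c : ℝ≥0∞) ^ d * (c * ∫⁻ y in A, ENNReal.ofReal (J y)) := by gcongr
        _ = _ := by ring
    · calc _ ≤ _ := i2
        _ ≤ c * ((c : ℝ≥0∞) ^ d * (μHE[d] : Measure E) (ψ '' A)) := by gcongr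
        _ = _ := by ring
  have limit : ∀ μ ν : Measure V, (∀ c : ℝ≥0, 1 < c → μ ≤ ((c : ℝ≥0∞) ^ (d + 1)) • ν) → μ ≤ ν := by
    intro μ ν h
    refine Measure.le_iff.2 fun s hs => ?_
    have ht : Filter.Tendsto (fun c : ℝ≥0 => (c : ℝ≥0∞) ^ (d + 1) * ν s) (𝓝[>] 1)
        (𝓝 (1 * ν s)) := by
      refine ENNReal.Tendsto.mul_const ?_ (Or.inl one_ne_zero)
      have : Filter.Tendsto (fun c : ℝ≥0 => (c : ℝ≥0∞) ^ (d + 1)) (𝓝 1) (𝓝 ((1 : ℝ≥0) ^ (d+1))) :=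
        ((ENNReal.continuous_pow (d + 1)).comp ENNReal.continuous_coe).tendsto 1
      simpa using this.mono_left nhdsWithin_le_nhds
    rw [one_mul] at ht
    refine ge_of_tendsto ht ?_
    filter_upwards [self_mem_nhdsWithin] with c hc
    simpa using Measure.le_iff.1 (h c hc) s hs
  refine le_antisymm (limit _ _ fun c hc => measure_le_of_locally_le fun y₀ => ?_)
    (limit _ _ fun c hc => measure_le_of_locally_le fun y₀ => ?_)
  all_goals
    obtain ⟨U, hU, h⟩ := key c hc y₀
    refine ⟨U, hU, fun A hA hAm => ?_⟩
    rw [Measure.smul_apply, hemb.comap_apply, withDensity_apply _ hAm, smul_eq_mul]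
  · exact (h A hA hAm).1
  · exact (h A hA hAm).2

end AreaFormula

/-! ### Projection onto a hyperplane, and traces. -/

section Linear

open InnerProductSpace

variable {E : Type*} [NormedAddCommGroup E] [InnerProductSpace ℝ E]

/-- The orthogonal projection `v ↦ v - (v · ν) ν` for a unit vector `ν`. -/
def tangentProj (ν : E) : E →L[ℝ] E := ContinuousLinearMap.id ℝ E - rankOne ℝ ν ν

theorem tangentProj_apply (ν v : E) : tangentProj ν v = v - inner ℝ ν v • ν := by
  simp [tangentProj]

theorem tangentProj_neg (ν : E) : tangentProj (-ν) = tangentProj ν := by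
  ext v; simp [tangentProj_apply]

theorem inner_tangentProj {ν : E} (hν : ‖ν‖ = 1) (v : E) : inner ℝ ν (tangentProj ν v) = 0 := by
  simp [tangentProj_apply, inner_sub_right, inner_smul_right, hν]

theorem inner_tangentProj_comm (ν v w : E) :
    inner ℝ (tangentProj ν v) w = inner ℝ v (tangentProj ν w) := by
  simp only [tangentProj_apply, inner_sub_right, inner_smul_right, inner_sub_left, inner_smul_left,
    real_inner_comm w ν, real_inner_comm v ν]
  simp; ring

theorem tangentProj_of_inner_eq_zero {ν v : E} (h : inner ℝ ν v = 0) : tangentProj ν v = v := by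
  simp [tangentProj_apply, h]

theorem continuous_tangentProj : Continuous (tangentProj : E → E →L[ℝ] E) := by
  exact continuous_const.sub ((rankOne ℝ).continuous.clm_apply continuous_id)

variable [FiniteDimensional ℝ E]

theorem trace_rankOne_comp (A : E →L[ℝ] E) (v w : E) :
    LinearMap.trace ℝ E (A ∘L rankOne ℝ v w : E →L[ℝ] E) = inner ℝ w (A v) := by
  have : A ∘L rankOne ℝ v w = rankOne ℝ (A v) w := by ext; simp
  rw [this, trace_rankOne]

theorem trace_comp_tangentProj (A : E →L[ℝ] E) (ν : E) :
    LinearMap.trace ℝ E (A ∘L tangentProj ν : E →L[ℝ] E) =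
      LinearMap.trace ℝ E (A : E →L[ℝ] E) - inner ℝ ν (A ν) := by
  rw [tangentProj, ContinuousLinearMap.comp_sub, ContinuousLinearMap.comp_id,
    ContinuousLinearMap.toLinearMap_sub, map_sub, trace_rankOne_comp]

theorem continuous_trace : Continuous fun A : E →L[ℝ] E => LinearMap.trace ℝ E (A : E →ₗ[ℝ] E) :=
  (LinearMap.continuous_of_finiteDimensional
    (LinearMap.trace ℝ E ∘ₗ (ContinuousLinearMap.coeLM ℝ : (E →L[ℝ] E) →ₗ[ℝ] (E →ₗ[ℝ] E))))

end Linear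

/-! ### Geometry of a single graph. -/

/-- The parameter space `ℝ^n` of graphs in `ℝ^{n+1}`. -/
abbrev Base (n : ℕ) : Type := EuclideanSpace ℝ (Fin n)

/-- The graph in `ℝ^{n+1}` of a smooth function `g` on `ℝ^n`, with respect to an orthogonal
decomposition of `ℝ^{n+1}` into a hyperplane, the range of `emb`, and a line, spanned by `e`. -/
structure Graph (n : ℕ) where
  emb : Base n →ₗᵢ[ℝ] Ambient n
  e : Ambient n
  g : Base n → ℝ
  norm_e : ‖e‖ = 1
  inner_emb_e : ∀ y, inner ℝ (emb y) e = 0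
  contDiff_g : ContDiff ℝ ∞ g

namespace Graph

variable {n : ℕ} (Γ : Graph n)

/-- The parametrization of the graph. -/
def param (y : Base n) : Ambient n := Γ.emb y + Γ.g y • Γ.e

/-- The orthogonal projection onto the parameter space. -/
def proj : Ambient n →L[ℝ] Base n := Γ.emb.toContinuousLinearMap.adjoint

/-- The graph, as a set. -/
def surface : Set (Ambient n) := Set.range Γ.param

/-- The gradient of the function `x ↦ x · e - g (proj x)`, which vanishes on the graph. -/
def conormal (y : Base n) : Ambient n := Γ.e - Γ.emb (gradient Γ.g y)

/-- The volume density of the graph in the parameter space. -/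
def jac (y : Base n) : ℝ := ‖Γ.conormal y‖

/-- The unit normal of the graph. -/
def normal (y : Base n) : Ambient n := (Γ.jac y)⁻¹ • Γ.conormal y

theorem inner_e_emb (y : Base n) : inner ℝ Γ.e (Γ.emb y) = 0 := by
  rw [real_inner_comm]; exact Γ.inner_emb_e y

theorem inner_proj_left (x : Ambient n) (y : Base n) :
    inner ℝ (Γ.proj x) y = inner ℝ x (Γ.emb y) := by
  simp [proj, ContinuousLinearMap.adjoint_inner_left]

@[simp] theorem proj_emb (y : Base n) : Γ.proj (Γ.emb y) = y := by
  refine ext_inner_right ℝ fun v => ?_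
  rw [inner_proj_left, Γ.emb.inner_map_map]

@[simp] theorem proj_e : Γ.proj Γ.e = 0 := by
  refine ext_inner_right ℝ fun v => ?_
  rw [inner_proj_left, inner_e_emb, inner_zero_left]

@[simp] theorem proj_param (y : Base n) : Γ.proj (Γ.param y) = y := by simp [param]

/-- Dimension count: `(y, t) ↦ emb y + t e` is injective between spaces of dimension `n + 1`, so
every `x` has this form. -/
theorem emb_proj_add (x : Ambient n) : Γ.emb (Γ.proj x) + inner ℝ Γ.e x • Γ.e = x := by
  set T : Base n × ℝ →ₗ[ℝ] Ambient n :=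
    Γ.emb.toLinearMap.coprod (LinearMap.toSpanSingleton ℝ _ Γ.e)
  have hT : ∀ p, T p = Γ.emb p.1 + p.2 • Γ.e := fun p => by simp [T]
  have hee : inner ℝ Γ.e Γ.e = 1 := by simp [Γ.norm_e]
  have hinj : Function.Injective T := by
    rw [injective_iff_map_eq_zero]
    intro p hp
    rw [hT] at hp
    have h1 : p.1 = 0 := by simpa using congrArg Γ.proj hp
    have h2 : p.2 = 0 := by
      simpa [inner_add_right, inner_e_emb, inner_smul_right, hee, Γ.norm_e] using
        congrArg (inner ℝ Γ.e) hp
    exact Prod.ext h1 h2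
  have hsurj : Function.Surjective T :=
    (LinearMap.injective_iff_surjective_of_finrank_eq_finrank (by simp)).1 hinj
  obtain ⟨p, rfl⟩ := hsurj x
  simp [hT, inner_add_right, inner_e_emb, inner_smul_right, Γ.norm_e]

theorem contDiff_param : ContDiff ℝ ∞ Γ.param :=
  Γ.emb.contDiff.add (Γ.contDiff_g.smul contDiff_const)

theorem continuous_param : Continuous Γ.param := Γ.contDiff_param.continuous

theorem injective_param : Function.Injective Γ.param :=
  Function.LeftInverse.injective Γ.proj_param

theorem param_proj {x : Ambient n} (hx : x ∈ Γ.surface) : Γ.param (Γ.proj x) = x := by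
  obtain ⟨y, rfl⟩ := hx
  simp

theorem isClosed_surface : IsClosed Γ.surface := by
  have : Γ.surface = {x | Γ.param (Γ.proj x) = x} :=
    Set.ext fun x => ⟨fun h => Γ.param_proj h, fun h => ⟨_, h⟩⟩
  rw [this]
  exact isClosed_eq (Γ.continuous_param.comp Γ.proj.continuous) continuous_id

theorem isCompact_preimage_param {K : Set (Ambient n)} (hK : IsCompact K) :
    IsCompact (Γ.param ⁻¹' K) := by
  have : Γ.param ⁻¹' K = Γ.proj '' (K ∩ Γ.surface) := by
    ext y
    constructor
    · exact fun h => ⟨Γ.param y, ⟨h, y, rfl⟩, by simp⟩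
    · rintro ⟨x, ⟨hx, hxS⟩, rfl⟩
      rwa [Set.mem_preimage, Γ.param_proj hxS]
  rw [this]
  exact (hK.inter_right Γ.isClosed_surface).image Γ.proj.continuous

/-- Pythagoras. This later reduces the integrability of negative powers of `|x|` on the graph to
that on `ℝ^n`. -/
theorem norm_le_norm_param (y : Base n) : ‖y‖ ≤ ‖Γ.param y‖ := by
  have h : ‖Γ.param y‖ ^ 2 = ‖y‖ ^ 2 + Γ.g y ^ 2 := by
    rw [param, norm_add_sq_real, inner_smul_right, Γ.inner_emb_e, norm_smul, Γ.norm_e,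
      Γ.emb.norm_map]
    simp
  exact le_of_sq_le_sq (by nlinarith [sq_nonneg (Γ.g y)]) (norm_nonneg _)

theorem fderiv_param (y v : Base n) :
    fderiv ℝ Γ.param y v = Γ.emb v + fderiv ℝ Γ.g y v • Γ.e := by
  have hg : DifferentiableAt ℝ Γ.g y := Γ.contDiff_g.differentiable (by simp) y
  have h := (Γ.emb.toContinuousLinearMap.hasFDerivAt (x := y)).add (hg.hasFDerivAt.smul_const Γ.e)
  have : HasFDerivAt Γ.param _ y := h
  rw [this.fderiv]
  simp

theorem proj_fderiv_param (y v : Base n) : Γ.proj (fderiv ℝ Γ.param y v) = v := by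
  simp [fderiv_param]

theorem contDiff_gradient : ContDiff ℝ ∞ (gradient Γ.g) :=
  (InnerProductSpace.toDual ℝ (Base n)).symm.contDiff.comp
    (Γ.contDiff_g.fderiv_right (m := ∞) (by simp))

theorem contDiff_conormal : ContDiff ℝ ∞ Γ.conormal :=
  contDiff_const.sub (Γ.emb.contDiff.comp Γ.contDiff_gradient)

theorem inner_e_conormal (y : Base n) : inner ℝ Γ.e (Γ.conormal y) = 1 := by
  simp [conormal, inner_sub_right, inner_e_emb, Γ.norm_e]

theorem conormal_ne_zero (y : Base n) : Γ.conormal y ≠ 0 := fun h => by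
  simpa [h] using Γ.inner_e_conormal y

theorem jac_pos (y : Base n) : 0 < Γ.jac y := norm_pos_iff.2 (Γ.conormal_ne_zero y)

theorem contDiff_jac : ContDiff ℝ ∞ Γ.jac := Γ.contDiff_conormal.norm ℝ Γ.conormal_ne_zero

theorem contDiff_normal : ContDiff ℝ ∞ Γ.normal :=
  (Γ.contDiff_jac.inv fun y => (Γ.jac_pos y).ne').smul Γ.contDiff_conormal

theorem norm_normal (y : Base n) : ‖Γ.normal y‖ = 1 :=
  norm_smul_inv_norm (𝕜 := ℝ) (Γ.conormal_ne_zero y)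

theorem conormal_eq (y : Base n) : Γ.conormal y = Γ.jac y • Γ.normal y := by
  rw [normal, smul_inv_smul₀ (Γ.jac_pos y).ne']

theorem inner_conormal (y : Base n) (v : Ambient n) :
    inner ℝ (Γ.conormal y) v = inner ℝ Γ.e v - fderiv ℝ Γ.g y (Γ.proj v) := by
  rw [conormal, inner_sub_left, real_inner_comm v (Γ.emb _), ← inner_proj_left]
  simp

/-- Orthogonality to the conormal says that the height component of `v` is the derivative of `g`
along `proj v`. -/
theorem fderiv_param_proj {y : Base n} {v : Ambient n} (hv : inner ℝ (Γ.normal y) v = 0) :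
    fderiv ℝ Γ.param y (Γ.proj v) = v := by
  have h : inner ℝ (Γ.conormal y) v = 0 := by
    rw [conormal_eq, inner_smul_left, hv, mul_zero]
  rw [inner_conormal, sub_eq_zero] at h
  rw [fderiv_param, ← h, emb_proj_add]

/-- The Gram operator is `v ↦ v + (∇g·v) ∇g`, a transvection of determinant `1 + |∇g|²`, which is
also the squared norm of the conormal. -/
theorem normDet_fderiv_param (y : Base n) :
    (fderiv ℝ Γ.param y : Base n →ₗ[ℝ] Ambient n).normDet = Γ.jac y := by
  have h1 := (fderiv ℝ Γ.param y).normDet_sq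
  have h2 : (((fderiv ℝ Γ.param y).adjoint ∘L fderiv ℝ Γ.param y : Base n →L[ℝ] Base n) :
      Base n →ₗ[ℝ] Base n) =
      LinearMap.transvection (fderiv ℝ Γ.g y : Base n →ₗ[ℝ] ℝ) (gradient Γ.g y) := by
    ext1 v
    refine ext_inner_right ℝ fun w => ?_
    simp [ContinuousLinearMap.adjoint_inner_left, fderiv_param, LinearMap.transvection.apply,
      inner_add_left, inner_add_right, inner_smul_left, inner_smul_right, inner_e_emb,
      Γ.inner_emb_e, Γ.norm_e]
  have h3 : Γ.jac y ^ 2 = 1 + fderiv ℝ Γ.g y (gradient Γ.g y) := by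
    rw [jac, ← real_inner_self_eq_norm_sq, inner_conormal, Γ.inner_e_conormal, conormal]
    simp
  rw [ContinuousLinearMap.det, h2, LinearMap.transvection.det] at h1
  have h4 : (fderiv ℝ Γ.param y : Base n →ₗ[ℝ] Ambient n).normDet ^ 2 = Γ.jac y ^ 2 := by
    rw [h3]; simpa using h1
  exact (sq_eq_sq₀ (LinearMap.normDet_nonneg _) (Γ.jac_pos y).le).1 h4

theorem measurableEmbedding_param : MeasurableEmbedding Γ.param :=
  Γ.continuous_param.measurableEmbedding Γ.injective_param

theorem restrict_surface :
    (μHE[n] : Measure (Ambient n)).restrict Γ.surface =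
      ((volume : Measure (Base n)).withDensity fun y => ENNReal.ofReal (Γ.jac y)).map Γ.param := by
  have h := comap_euclideanHausdorffMeasure_eq_withDensity
    (Γ.contDiff_param.of_le (by simp)) Γ.injective_param fun y =>
      Function.LeftInverse.injective (g := Γ.proj) (Γ.proj_fderiv_param y)
  simp only [normDet_fderiv_param, finrank_euclideanSpace, Fintype.card_fin] at h
  rw [← h, Γ.measurableEmbedding_param.map_comap, surface]

theorem measurable_ofReal_jac : Measurable fun y => ENNReal.ofReal (Γ.jac y) :=
  ENNReal.measurable_ofReal.comp Γ.contDiff_jac.continuous.measurable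

theorem setIntegral_surface (h : Ambient n → ℝ) :
    ∫ x in Γ.surface, h x ∂(μHE[n] : Measure (Ambient n)) =
      ∫ y, Γ.jac y * h (Γ.param y) := by
  rw [restrict_surface, Γ.measurableEmbedding_param.integral_map,
    integral_withDensity_eq_integral_toReal_smul
      Γ.measurable_ofReal_jac (by simp)]
  simp [ENNReal.toReal_ofReal (Γ.jac_pos _).le]

theorem integrableOn_surface_iff {h : Ambient n → ℝ} :
    IntegrableOn h Γ.surface (μHE[n] : Measure (Ambient n)) ↔
      Integrable fun y => Γ.jac y * h (Γ.param y) := by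
  rw [IntegrableOn, restrict_surface, Γ.measurableEmbedding_param.integrable_map_iff,
    integrable_withDensity_iff_integrable_smul'
      Γ.measurable_ofReal_jac (by simp)]
  simp [ENNReal.toReal_ofReal (Γ.jac_pos _).le]

/-- The tangential divergence of a vector field along the graph, in terms of the parametrization. -/
def div (Z : Base n → Ambient n) (y : Base n) : ℝ :=
  LinearMap.trace ℝ (Ambient n)
    ((fderiv ℝ Z y ∘L Γ.proj) ∘L tangentProj (Γ.normal y) : Ambient n →L[ℝ] Ambient n)

theorem div_eq (Z : Base n → Ambient n) (y : Base n) :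
    Γ.div Z y = LinearMap.trace ℝ (Ambient n) (fderiv ℝ Z y ∘L Γ.proj : Ambient n →L[ℝ] Ambient n) -
      inner ℝ (Γ.normal y) (fderiv ℝ Z y (Γ.proj (Γ.normal y))) := by
  rw [div, trace_comp_tangentProj]; rfl

/-- Both sides are minus the Hessian of `g` at `(proj u, proj w)`: this is the symmetry of second
derivatives. -/
theorem inner_fderiv_conormal_comm (y : Base n) (u w : Ambient n) :
    inner ℝ (fderiv ℝ Γ.conormal y (Γ.proj u)) w =
      inner ℝ (fderiv ℝ Γ.conormal y (Γ.proj w)) u := by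
  have hd : DifferentiableAt ℝ Γ.conormal y := Γ.contDiff_conormal.differentiable (by simp) y
  have hD : DifferentiableAt ℝ (fderiv ℝ Γ.g) y :=
    (Γ.contDiff_g.fderiv_right (m := ∞) (by simp)).differentiable (by simp) y
  have key : ∀ (v : Base n) (w : Ambient n), inner ℝ (fderiv ℝ Γ.conormal y v) w =
      -fderiv ℝ (fderiv ℝ Γ.g) y v (Γ.proj w) := by
    intro v w
    have h1 : HasFDerivAt (fun z => inner ℝ w (Γ.conormal z))
        ((innerSL ℝ w) ∘L fderiv ℝ Γ.conormal y) y :=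
      (innerSL ℝ w).hasFDerivAt.comp y hd.hasFDerivAt
    have h2 : HasFDerivAt (fun z => inner ℝ Γ.e w - fderiv ℝ Γ.g z (Γ.proj w))
        (-((ContinuousLinearMap.apply ℝ ℝ (Γ.proj w)) ∘L fderiv ℝ (fderiv ℝ Γ.g) y)) y :=
      (((ContinuousLinearMap.apply ℝ ℝ (Γ.proj w)).hasFDerivAt.comp y hD.hasFDerivAt)).const_sub _
    have h3 : (fun z => inner ℝ w (Γ.conormal z)) =
        fun z => inner ℝ Γ.e w - fderiv ℝ Γ.g z (Γ.proj w) := by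
      ext z; rw [real_inner_comm, inner_conormal]
    rw [h3] at h1
    have := congrArg (fun L : Base n →L[ℝ] ℝ => L v) (h1.unique h2)
    simpa [real_inner_comm] using this
  have hsymm : IsSymmSndFDerivAt ℝ Γ.g y :=
    (contDiff_infty.1 Γ.contDiff_g 2).contDiffAt.isSymmSndFDerivAt (by simp)
  rw [key, key, hsymm]

theorem inner_normal_fderiv_normal (y v : Base n) :
    inner ℝ (Γ.normal y) (fderiv ℝ Γ.normal y v) = 0 := by
  have hd := (Γ.contDiff_normal.differentiable (by simp) y).hasFDerivAt
  have h1 := hd.inner ℝ hd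
  have h2 : (fun z => inner ℝ (Γ.normal z) (Γ.normal z)) = fun _ => (1 : ℝ) := by
    ext z; simp [Γ.norm_normal]
  rw [h2] at h1
  have := congrArg (fun L : Base n →L[ℝ] ℝ => L v) (h1.unique (hasFDerivAt_const _ _))
  simp [real_inner_comm] at this
  simpa [real_inner_comm] using this

/-- Insert `conormal = J ν` into the symmetry of the conormal derivative at `(T, ν)`; `ν·T = 0` and
`ν·Dν = 0` kill the other terms. -/
theorem fderiv_jac_eq {y : Base n} {T : Ambient n} (hT : inner ℝ (Γ.normal y) T = 0) :
    fderiv ℝ Γ.jac y (Γ.proj T) =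
      Γ.jac y * inner ℝ (fderiv ℝ Γ.normal y (Γ.proj (Γ.normal y))) T := by
  have hN := (Γ.contDiff_normal.differentiable (by simp) y).hasFDerivAt
  have hJ := (Γ.contDiff_jac.differentiable (by simp) y).hasFDerivAt
  have h := hJ.smul hN
  have e1 : Γ.jac • Γ.normal = Γ.conormal := funext fun z => (Γ.conormal_eq z).symm
  have e2 : fderiv ℝ Γ.conormal y =
      Γ.jac y • fderiv ℝ Γ.normal y + (fderiv ℝ Γ.jac y).smulRight (Γ.normal y) := by
    rw [← e1]; exact h.fderiv
  have key := Γ.inner_fderiv_conormal_comm y T (Γ.normal y)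
  rw [e2] at key
  have h0 := Γ.inner_normal_fderiv_normal y (Γ.proj T)
  rw [real_inner_comm] at h0
  simpa [inner_add_left, inner_smul_left, h0, hT, Γ.norm_normal] using key

/-- The tangential divergence of the tangential part of `Z`, as a divergence in the parameter
space. -/
theorem trace_fderiv_jac_smul_tangential {Z : Base n → Ambient n} {y : Base n}
    (hZ : DifferentiableAt ℝ Z y) :
    LinearMap.trace ℝ (Ambient n)
      (fderiv ℝ (fun z => Γ.jac z • (Z z - inner ℝ (Γ.normal z) (Z z) • Γ.normal z)) y ∘L Γ.proj :
        Ambient n →L[ℝ] Ambient n) =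
      Γ.jac y * (Γ.div Z y - Γ.div Γ.normal y * inner ℝ (Γ.normal y) (Z y)) := by
  have hN := (Γ.contDiff_normal.differentiable (by simp) y).hasFDerivAt
  have hJ := (Γ.contDiff_jac.differentiable (by simp) y).hasFDerivAt
  have h := hJ.smul (hZ.hasFDerivAt.sub ((hN.inner ℝ hZ.hasFDerivAt).smul hN))
  have h' : HasFDerivAt
      (fun z => Γ.jac z • (Z z - inner ℝ (Γ.normal z) (Z z) • Γ.normal z)) _ y := h
  rw [h'.fderiv]
  set T := Z y - inner ℝ (Γ.normal y) (Z y) • Γ.normal y with hTdef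
  have hT : inner ℝ (Γ.normal y) T = 0 := by
    simp [hTdef, inner_sub_right, inner_smul_right, Γ.norm_normal]
  -- Differentiating `J` contributes `J Dν(proj ν)·Z`, which cancels the like term coming from the
  -- derivative of `ν·Z`.
  have hJT := Γ.fderiv_jac_eq hT
  have hNN := Γ.inner_normal_fderiv_normal y (Γ.proj (Γ.normal y))
  have hNT : inner ℝ (fderiv ℝ Γ.normal y (Γ.proj (Γ.normal y))) T =
      inner ℝ (fderiv ℝ Γ.normal y (Γ.proj (Γ.normal y))) (Z y) := by
    rw [hTdef, inner_sub_right, inner_smul_right, real_inner_comm (Γ.normal y), hNN]; simp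
  have tr1 : ∀ (a : Base n →L[ℝ] ℝ) (w : Ambient n), LinearMap.trace ℝ (Ambient n)
      ((a.smulRight w) ∘L Γ.proj : Ambient n →L[ℝ] Ambient n) = a (Γ.proj w) := by
    intro a w
    have : (a.smulRight w) ∘L Γ.proj = InnerProductSpace.rankOne ℝ w
        ((InnerProductSpace.toDual ℝ (Ambient n)).symm (a ∘L Γ.proj)) := by
      ext1 v; simp
    rw [this, InnerProductSpace.trace_rankOne]
    simp
  simp only [ContinuousLinearMap.add_comp, ContinuousLinearMap.sub_comp,
    ContinuousLinearMap.smul_comp, ContinuousLinearMap.toLinearMap_add,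
    ContinuousLinearMap.toLinearMap_sub,
    ContinuousLinearMap.toLinearMap_smul, map_add, map_sub, map_smul, tr1, smul_eq_mul, div_eq]
  have hT' : (Z - (fun t => inner ℝ (Γ.normal t) (Z t)) • Γ.normal) y = T := rfl
  rw [hT', hJT, hNT, hNN]
  simp only [ContinuousLinearMap.comp_apply, ContinuousLinearMap.prod_apply, fderivInnerCLM_apply]
  ring

end Graph

/-! ### Hypersurfaces as local graphs. -/

variable {n : ℕ}

/-- Inside the open set `W`, the set `M` coincides with the graph. -/
def Graph.IsChartOn (Γ : Graph n) (M W : Set (Ambient n)) : Prop :=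
  IsOpen W ∧ M ∩ W = Γ.surface ∩ W

theorem exists_flat_graph {e : Ambient n} (he : ‖e‖ = 1) : ∃ Γ : Graph n, Γ.e = e := by
  have he0 : e ≠ 0 := fun h => by simp [h] at he
  have : Fact (Module.finrank ℝ (Ambient n) = n + 1) := ⟨by simp⟩
  let b := OrthonormalBasis.fromOrthogonalSpanSingleton (𝕜 := ℝ) n he0
  refine ⟨⟨(Submodule.subtypeₗᵢ _).comp b.repr.symm.toLinearIsometry, e, fun _ => 0, he,
    fun y => ?_, contDiff_const⟩, rfl⟩
  rw [real_inner_comm]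
  exact Submodule.mem_orthogonal_singleton_iff_inner_right.1 (b.repr.symm y).2

/-- The derivative of `x ↦ (proj x, f x)`, as an equivalence. -/
def Graph.projProdEquiv (Γ : Graph n) (A : Ambient n →L[ℝ] ℝ) (hA : A Γ.e ≠ 0) :
    Ambient n ≃L[ℝ] Base n × ℝ :=
  (LinearEquiv.ofInjectiveOfFinrankEq (Γ.proj.prod A : Ambient n →ₗ[ℝ] Base n × ℝ) (by
    rw [injective_iff_map_eq_zero]
    intro v hv
    have h1 : Γ.proj v = 0 := congrArg Prod.fst hv
    have h2 : A v = 0 := congrArg Prod.snd hv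
    have h3 := Γ.emb_proj_add v
    rw [h1, map_zero, zero_add] at h3
    rw [← h3, map_smul, smul_eq_mul] at h2
    rw [← h3, (mul_eq_zero.1 h2).resolve_right hA, zero_smul])
    (by simp)).toContinuousLinearEquiv

/-- A smooth hypersurface is locally a graph. -/
theorem IsSmoothHypersurface.exists_graph {M : Set (Ambient n)} (hM : IsSmoothHypersurface M)
    {p : Ambient n} (hp : p ∈ M) : ∃ (Γ : Graph n) (W : Set (Ambient n)),
      Γ.IsChartOn M W ∧ p ∈ W := by
  obtain ⟨U, f, hU, hpU, hf, hdf, hMU⟩ := hM p hp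
  have hg0 : gradient f p ≠ 0 := by simpa [gradient] using hdf p ⟨hp, hpU⟩
  -- The vertical direction is that of the gradient of `f` at `p`, so the vertical derivative of `f`
  -- is nonzero at `p`, hence on a neighbourhood `U'`.
  obtain ⟨Γ₀, hΓ₀⟩ := exists_flat_graph (norm_smul_inv_norm (𝕜 := ℝ) hg0)
  have hAp : fderiv ℝ f p Γ₀.e ≠ 0 := by
    rw [hΓ₀, map_smul, ← inner_gradient_left]
    simpa using hg0
  have hfU : ∀ x ∈ U, ContDiffAt ℝ ∞ f x := fun x hx => hf.contDiffAt (hU.mem_nhds hx)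
  have hdc : ContinuousOn (fun x => fderiv ℝ f x Γ₀.e) U :=
    (hf.continuousOn_fderiv_of_isOpen hU (by simp)).clm_apply continuousOn_const
  set U' := U ∩ (fun x => fderiv ℝ f x Γ₀.e) ⁻¹' {0}ᶜ
  have hU' : IsOpen U' := hdc.isOpen_inter_preimage hU isOpen_compl_singleton
  have hA : ∀ x ∈ U', fderiv ℝ f x Γ₀.e ≠ 0 := fun x hx => hx.2
  set Φ : Ambient n → Base n × ℝ := fun x => (Γ₀.proj x, f x)
  have hΦ : ∀ x ∈ U, ContDiffAt ℝ ∞ Φ x := fun x hx => Γ₀.proj.contDiff.contDiffAt.prodMk (hfU x hx)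
  have hΦ' : ∀ x (hx : x ∈ U'), HasFDerivAt Φ
      (Γ₀.projProdEquiv (fderiv ℝ f x) (hA x hx) : Ambient n →L[ℝ] Base n × ℝ) x := fun x hx =>
    Γ₀.proj.hasFDerivAt.prodMk ((hfU x hx.1).differentiableAt (by simp)).hasFDerivAt
  have hpU' : p ∈ U' := ⟨hpU, hAp⟩
  -- The inverse function theorem straightens `M` to the slice `f = 0`; the height `g₀` is read off
  -- from the inverse on that slice.
  set P := (hΦ p hpU).toOpenPartialHomeomorph Φ (hΦ' p hpU') (by simp)
  have hPΦ : ∀ x, P x = Φ x := fun x => rfl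
  have hpP : p ∈ P.source := (hΦ p hpU).mem_toOpenPartialHomeomorph_source (hΦ' p hpU') (by simp)
  set T := P.target ∩ P.symm ⁻¹' U'
  have hT : IsOpen T := P.isOpen_inter_preimage_symm hU'
  have hfp : f p = 0 := (hMU.subset ⟨hp, hpU⟩).2
  have hPp : P p = (Γ₀.proj p, 0) := by rw [hPΦ]; simp [Φ, hfp]
  have hpT : (Γ₀.proj p, (0 : ℝ)) ∈ T := by
    rw [← hPp]
    exact ⟨P.map_source hpP, by simpa [P.left_inv hpP] using hpU'⟩
  set Ω : Set (Base n) := (fun y => (y, (0 : ℝ))) ⁻¹' T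
  have hΩ : IsOpen Ω := hT.preimage (by fun_prop)
  set g₀ : Base n → ℝ := fun y => inner ℝ Γ₀.e (P.symm (y, 0))
  have hg₀ : ∀ y ∈ Ω, ContDiffAt ℝ ∞ g₀ y := by
    intro y hy
    have h1 : ContDiffAt ℝ ∞ P.symm (y, (0 : ℝ)) :=
      P.contDiffAt_symm hy.1 (hΦ' _ hy.2) (hΦ _ hy.2.1)
    exact (innerSL ℝ Γ₀.e).contDiff.contDiffAt.comp y
      (h1.comp y (contDiffAt_id.prodMk contDiffAt_const))
  obtain ⟨r, hr, hrΩ⟩ := Metric.isOpen_iff.1 hΩ _ hpT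
  -- A `Graph` needs a function smooth on all of `ℝ^n`, while `g₀` is only controlled on `Ω`. The
  -- cutoff is `1` on the ball of radius `r / 4`, where the chart lives.
  let χ : ContDiffBump (Γ₀.proj p) := ⟨r / 4, r / 2, by positivity, by linarith⟩
  have hχΩ : tsupport χ ⊆ Ω := by
    rw [χ.tsupport_eq]
    exact (Metric.closedBall_subset_ball (by change r / 2 < r; linarith)).trans hrΩ
  have hg : ContDiff ℝ ∞ fun y => χ y * g₀ y := by
    rw [contDiff_iff_contDiffAt]
    intro y
    by_cases hy : y ∈ tsupport χ
    · exact χ.contDiffAt.mul (hg₀ y (hχΩ hy))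
    · refine (contDiffAt_const (c := (0 : ℝ))).congr_of_eventuallyEq ?_
      filter_upwards [notMem_tsupport_iff_eventuallyEq.1 hy] with z hz
      simp [hz]
  let Γ : Graph n := ⟨Γ₀.emb, Γ₀.e, fun y => χ y * g₀ y, Γ₀.norm_e, Γ₀.inner_emb_e, hg⟩
  have hproj : Γ.proj = Γ₀.proj := rfl
  have hgB : ∀ y ∈ Metric.ball (Γ₀.proj p) (r / 4), Γ.g y = g₀ y := fun y hy => by
    have : χ y = 1 := χ.one_of_mem_closedBall (Metric.ball_subset_closedBall hy)
    simp [Γ, this]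
  refine ⟨Γ, (P.source ∩ U') ∩ Γ₀.proj ⁻¹' Metric.ball (Γ₀.proj p) (r / 4),
    ⟨(P.open_source.inter hU').inter (Metric.isOpen_ball.preimage Γ₀.proj.continuous), ?_⟩,
    ⟨hpP, hpU'⟩, Metric.mem_ball_self (by positivity)⟩
  ext x
  refine and_congr_left fun hx => ⟨fun hxM => ?_, ?_⟩
  · refine ⟨Γ₀.proj x, ?_⟩
    have hfx : f x = 0 := (hMU.subset ⟨hxM, hx.1.2.1⟩).2
    have hPx : P x = (Γ₀.proj x, 0) := by rw [hPΦ]; simp [Φ, hfx]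
    have : P.symm (Γ₀.proj x, 0) = x := by rw [← hPx, P.left_inv hx.1.1]
    rw [Graph.param, hgB _ hx.2]
    simp only [g₀, this]
    exact Γ₀.emb_proj_add x
  · intro hxS
    have hxb := hx.2
    have hxΩ : Γ₀.proj x ∈ Ω := hrΩ (Metric.ball_subset_ball (by linarith) hxb)
    -- `z` is a zero of `f` with the same projection and height as `x`, hence equals `x`.
    set z := P.symm (Γ₀.proj x, 0)
    have hPz : Φ z = (Γ₀.proj x, 0) := P.right_inv hxΩ.1
    have hz1 : Γ₀.proj z = Γ₀.proj x := congrArg Prod.fst hPz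
    have hz2 : f z = 0 := congrArg Prod.snd hPz
    have hzx : z = x := by
      rw [← Γ.param_proj hxS, Graph.param, hproj, hgB _ hxb, ← Γ₀.emb_proj_add z, hz1]
    rw [← hzx]
    exact (hMU.superset ⟨hxΩ.2.1, hz2⟩).1

/-- `M` agrees near each of its points with a graph, which is closed; so `M` is locally closed. -/
theorem IsSmoothHypersurface.measurableSet {M : Set (Ambient n)} (hM : IsSmoothHypersurface M) :
    MeasurableSet M := by
  have : IsLocallyClosed M := by
    refine ((isLocallyClosed_tfae M).out 0 2).2 fun p hp => ?_
    obtain ⟨Γ, W, ⟨hW, hMW⟩, hpW⟩ := hM.exists_graph hp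
    refine ⟨W, hW.mem_nhds hpW, ?_⟩
    have : (Subtype.val ⁻¹' M : Set W) = Subtype.val ⁻¹' Γ.surface := by
      rw [← Subtype.preimage_coe_inter_self, hMW, Subtype.preimage_coe_inter_self]
    rw [this]
    exact Γ.isClosed_surface.preimage continuous_subtype_val
  obtain ⟨U, Z, hU, hZ, rfl⟩ := this
  exact hU.measurableSet.inter hZ.measurableSet

theorem IsSmoothHypersurface.continuousOn_of_graph {F : Type*} [TopologicalSpace F]
    {M : Set (Ambient n)} (hM : IsSmoothHypersurface M) {q : Ambient n → F}
    (h : ∀ (Γ : Graph n) (W : Set (Ambient n)), Γ.IsChartOn M W →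
      ContinuousOn (fun y => q (Γ.param y)) (Γ.param ⁻¹' W)) : ContinuousOn q M := by
  refine continuousOn_of_locally_continuousOn fun p hp => ?_
  obtain ⟨Γ, W, hW, hpW⟩ := hM.exists_graph hp
  refine ⟨W, hW.1, hpW, ?_⟩
  have h1 : ContinuousOn (fun x => q (Γ.param (Γ.proj x))) (M ∩ W) := by
    refine (h Γ W hW).comp Γ.proj.continuous.continuousOn fun x hx => ?_
    rw [hW.2] at hx
    rw [Set.mem_preimage, Γ.param_proj hx.1]
    exact hx.2
  refine h1.congr fun x hx => ?_
  rw [hW.2] at hx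
  simp only [Γ.param_proj hx.1]

/-! ### Derivatives and normals of `M` read in a graph chart. -/

namespace Graph.IsChartOn

variable {Γ : Graph n} {M W : Set (Ambient n)} (h : Γ.IsChartOn M W)
include h

theorem param_mem {y : Base n} (hy : Γ.param y ∈ W) : Γ.param y ∈ M :=
  (h.2.superset ⟨⟨y, rfl⟩, hy⟩).1

theorem isOpen_preimage : IsOpen (Γ.param ⁻¹' W) := h.1.preimage Γ.continuous_param

theorem param_proj {x : Ambient n} (hx : x ∈ M ∩ W) : Γ.param (Γ.proj x) = x :=
  Γ.param_proj (h.2.subset hx).1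

theorem contDiffOn_comp {F : Type*} [NormedAddCommGroup F] [NormedSpace ℝ F] {Z : Ambient n → F}
    (hZ : ContDiffOn ℝ 1 Z M) : ContDiffOn ℝ 1 (fun y => Z (Γ.param y)) (Γ.param ⁻¹' W) :=
  hZ.comp (Γ.contDiff_param.of_le (by simp)).contDiffOn fun _ hy => h.param_mem hy

theorem hasFDerivAt_comp {F : Type*} [NormedAddCommGroup F] [NormedSpace ℝ F] {Z : Ambient n → F}
    {L : Ambient n →L[ℝ] F} {y : Base n} (hy : Γ.param y ∈ W)
    (hZ : HasFDerivWithinAt Z L M (Γ.param y)) :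
    HasFDerivAt (fun z => Z (Γ.param z)) (L ∘L fderiv ℝ Γ.param y) y := by
  have hψ : HasFDerivAt Γ.param (fderiv ℝ Γ.param y) y :=
    (Γ.contDiff_param.differentiable (by simp) y).hasFDerivAt
  have := hZ.comp y (hψ.hasFDerivWithinAt (s := Γ.param ⁻¹' W)) fun z hz => h.param_mem hz
  exact this.hasFDerivAt (h.isOpen_preimage.mem_nhds hy)

/-- The restriction of a derivative along `M` to the tangent space, read in the parametrization. -/
theorem fderiv_comp_proj {F : Type*} [NormedAddCommGroup F] [NormedSpace ℝ F] {Z : Ambient n → F}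
    {L : Ambient n →L[ℝ] F} {y : Base n} (hy : Γ.param y ∈ W)
    (hZ : HasFDerivWithinAt Z L M (Γ.param y)) :
    (fderiv ℝ (fun z => Z (Γ.param z)) y ∘L Γ.proj) ∘L tangentProj (Γ.normal y) =
      L ∘L tangentProj (Γ.normal y) := by
  rw [(h.hasFDerivAt_comp hy hZ).fderiv]
  ext1 v
  simp only [ContinuousLinearMap.comp_apply]
  rw [Γ.fderiv_param_proj (inner_tangentProj (Γ.norm_normal y) v)]

/-- The range of the derivative of `param` lies in the tangent cone. The tangential part of `v` is
in that range, so it is orthogonal to `v` and hence to itself. -/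
theorem eq_or_eq_neg_of_isUnitNormalAt {y : Base n} (hy : Γ.param y ∈ W) {v : Ambient n}
    (hv : IsUnitNormalAt M (Γ.param y) v) : v = Γ.normal y ∨ v = -Γ.normal y := by
  have hψ : HasFDerivAt Γ.param (fderiv ℝ Γ.param y) y :=
    (Γ.contDiff_param.differentiable (by simp) y).hasFDerivAt
  have hmem : ∀ w, fderiv ℝ Γ.param y w ∈ tangentConeAt ℝ M (Γ.param y) := by
    intro w
    have h1 := (hψ.hasFDerivWithinAt (s := Γ.param ⁻¹' W)).mapsTo_tangent_cone
    have h2 : w ∈ tangentConeAt ℝ (Γ.param ⁻¹' W) y := by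
      rw [tangentConeAt_of_mem_nhds (h.isOpen_preimage.mem_nhds hy)]
      trivial
    refine tangentConeAt_mono ?_ (h1 h2)
    rintro _ ⟨z, hz, rfl⟩
    exact h.param_mem hz
  have h3 : tangentProj (Γ.normal y) v = 0 := by
    have h4 := Γ.fderiv_param_proj (inner_tangentProj (Γ.norm_normal y) v)
    have h5 : inner ℝ (tangentProj (Γ.normal y) v) v = 0 := by
      rw [← h4]; exact hv.2 _ (hmem _)
    have h6 : inner ℝ (tangentProj (Γ.normal y) v) (tangentProj (Γ.normal y) v) = 0 := by
      rw [← inner_tangentProj_comm, tangentProj_of_inner_eq_zero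
        (inner_tangentProj (Γ.norm_normal y) v), h5]
    exact inner_self_eq_zero.1 h6
  rw [tangentProj_apply, sub_eq_zero] at h3
  have h7 : |inner ℝ (Γ.normal y) v| = 1 := by
    have := hv.1
    rw [h3, norm_smul, Γ.norm_normal, mul_one] at this
    simpa using this
  rcases eq_or_eq_neg_of_abs_eq h7 with h8 | h8 <;> rw [h8] at h3
  · left; simpa using h3
  · right; simpa using h3

/-- Any field of unit normals near a point is, up to a sign, the normal of the graph. -/
theorem exists_sign {y : Base n} (hy : Γ.param y ∈ W) {N : Ambient n → Ambient n}
    (hN : IsLocalUnitNormalField M (Γ.param y) N) :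
    ∃ s : ℝ, s ^ 2 = 1 ∧ N =ᶠ[𝓝[M] Γ.param y] fun x => s • Γ.normal (Γ.proj x) := by
  obtain ⟨U, hU, hyU, hNU, hNn⟩ := hN
  set x₀ := Γ.param y
  -- `σ` is continuous at `x₀` and equals `±1` on `M` nearby, so its sign is constant there.
  set σ : Ambient n → ℝ := fun x => inner ℝ (Γ.normal (Γ.proj x)) (N x)
  have hcN : ContinuousAt N x₀ := hNU.continuousOn.continuousAt (hU.mem_nhds hyU)
  have hσ : ContinuousAt σ x₀ :=
    ((Γ.contDiff_normal.continuous.comp Γ.proj.continuous).continuousAt).inner hcN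
  have hpm : ∀ x ∈ M ∩ (W ∩ U), (σ x = 1 ∧ N x = Γ.normal (Γ.proj x)) ∨
      (σ x = -1 ∧ N x = -Γ.normal (Γ.proj x)) := by
    intro x hx
    have hx' := h.param_proj ⟨hx.1, hx.2.1⟩
    have hn := hNn x ⟨hx.1, hx.2.2⟩
    rw [← hx'] at hn
    have := h.eq_or_eq_neg_of_isUnitNormalAt (by rw [hx']; exact hx.2.1) hn
    rw [hx'] at this
    rcases this with h1 | h1
    · left; simp [σ, h1, Γ.norm_normal]
    · right; simp [σ, h1, Γ.norm_normal]
  have hx₀M : x₀ ∈ M := h.param_mem hy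
  have hev : ∀ᶠ x in 𝓝[M] x₀, x ∈ M ∩ (W ∩ U) := by
    filter_upwards [self_mem_nhdsWithin, mem_nhdsWithin_of_mem_nhds (h.1.mem_nhds hy),
      mem_nhdsWithin_of_mem_nhds (hU.mem_nhds hyU)] with x h1 h2 h3
    exact ⟨h1, h2, h3⟩
  rcases hpm x₀ ⟨hx₀M, hy, hyU⟩ with h0 | h0
  · refine ⟨1, by simp, ?_⟩
    have : ∀ᶠ x in 𝓝[M] x₀, 0 < σ x :=
      mem_nhdsWithin_of_mem_nhds (hσ.eventually_const_lt (by rw [h0.1]; norm_num))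
    filter_upwards [hev, this] with x hx hx'
    rcases hpm x hx with h1 | h1
    · simp [h1.2]
    · rw [h1.1] at hx'; norm_num at hx'
  · refine ⟨-1, by simp, ?_⟩
    have : ∀ᶠ x in 𝓝[M] x₀, σ x < 0 :=
      mem_nhdsWithin_of_mem_nhds (hσ.eventually_lt_const (by rw [h0.1]; norm_num))
    filter_upwards [hev, this] with x hx hx'
    rcases hpm x hx with h1 | h1
    · rw [h1.1] at hx'; norm_num at hx'
    · simp [h1.2]

end Graph.IsChartOn

theorem sum_smul_single (v : Ambient n) : ∑ j, v j • EuclideanSpace.single j (1 : ℝ) = v := by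
  have := (EuclideanSpace.basisFun (Fin (n + 1)) ℝ).sum_repr v
  simpa using this

theorem tangentialDeriv_eq_fderivWithin (M : Set (Ambient n)) (i : Fin (n + 1)) (φ : Ambient n → ℝ)
    (x : Ambient n) : tangentialDeriv M i φ x = fderivWithin ℝ φ M x
      (tangentProj (unitNormal M x) (EuclideanSpace.single i 1)) := by
  have h : ∑ j, extPartialDeriv M j φ x * unitNormal M x j =
      fderivWithin ℝ φ M x (unitNormal M x) := by
    conv_rhs => rw [← sum_smul_single (unitNormal M x)]
    simp [extPartialDeriv, mul_comm]
  rw [tangentialDeriv, h, tangentProj_apply, map_sub, map_smul]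
  simp [extPartialDeriv, EuclideanSpace.inner_single_right]

theorem IsSmoothHypersurface.isLocalUnitNormalField_localUnitNormal {M : Set (Ambient n)}
    (hM : IsSmoothHypersurface M) {x : Ambient n} (hx : x ∈ M) :
    IsLocalUnitNormalField M x (localUnitNormal M x) :=
  Classical.epsilon_spec (hM.exists_isLocalUnitNormalField hx)

theorem IsSmoothHypersurface.norm_unitNormal {M : Set (Ambient n)}
    (hM : IsSmoothHypersurface M) {x : Ambient n} (hx : x ∈ M) : ‖unitNormal M x‖ = 1 := by
  obtain ⟨U, -, hxU, -, h⟩ := hM.isLocalUnitNormalField_localUnitNormal hx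
  exact (h x ⟨hx, hxU⟩).1

namespace Graph.IsChartOn

variable {Γ : Graph n} {M W : Set (Ambient n)} (h : Γ.IsChartOn M W)
include h

theorem exists_sign_unitNormal (hM : IsSmoothHypersurface M) {y : Base n} (hy : Γ.param y ∈ W) :
    ∃ s : ℝ, s ^ 2 = 1 ∧ unitNormal M (Γ.param y) = s • Γ.normal y ∧
      localUnitNormal M (Γ.param y) =ᶠ[𝓝[M] Γ.param y] fun x => s • Γ.normal (Γ.proj x) := by
  have hx := h.param_mem hy
  obtain ⟨s, hs, hev⟩ := h.exists_sign hy (hM.isLocalUnitNormalField_localUnitNormal hx)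
  exact ⟨s, hs, by simpa [unitNormal] using hev.eq_of_nhdsWithin hx, hev⟩

theorem tangentProj_unitNormal (hM : IsSmoothHypersurface M) {y : Base n} (hy : Γ.param y ∈ W) :
    tangentProj (unitNormal M (Γ.param y)) = tangentProj (Γ.normal y) := by
  obtain ⟨s, hs, h1, -⟩ := h.exists_sign_unitNormal hM hy
  rcases sq_eq_sq_iff_eq_or_eq_neg.1 (hs.trans (one_pow 2).symm) with h2 | h2 <;>
    simp [h1, h2, tangentProj_neg]

end Graph.IsChartOn

/-! ### Tangential derivative, gradient, divergence and mean curvature, free of coordinates. -/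

section TangentialCalculus

variable {M : Set (Ambient n)} (hM : IsSmoothHypersurface M)
include hM

/-- Tangential derivatives do not depend on the choice of a derivative along `M`. -/
theorem IsSmoothHypersurface.fderivWithin_comp_tangentProj {F : Type*} [NormedAddCommGroup F]
    [NormedSpace ℝ F] {φ : Ambient n → F} {L : Ambient n →L[ℝ] F} {x : Ambient n} (hx : x ∈ M)
    (hφ : HasFDerivWithinAt φ L M x) :
    fderivWithin ℝ φ M x ∘L tangentProj (unitNormal M x) = L ∘L tangentProj (unitNormal M x) := by
  obtain ⟨Γ, W, h, hxW⟩ := hM.exists_graph hx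
  have hx' := h.param_proj ⟨hx, hxW⟩
  rw [← hx'] at hφ hxW ⊢
  rw [h.tangentProj_unitNormal hM hxW, ← h.fderiv_comp_proj hxW hφ,
    ← h.fderiv_comp_proj hxW hφ.differentiableWithinAt.hasFDerivWithinAt]

theorem IsSmoothHypersurface.tangentialDeriv_eq {φ : Ambient n → ℝ} {L : Ambient n →L[ℝ] ℝ}
    {x : Ambient n} (hx : x ∈ M) (hφ : HasFDerivWithinAt φ L M x) (i : Fin (n + 1)) :
    tangentialDeriv M i φ x =
      L (tangentProj (unitNormal M x) (EuclideanSpace.single i 1)) := by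
  rw [tangentialDeriv_eq_fderivWithin]
  exact congrArg (fun A : Ambient n →L[ℝ] ℝ => A (EuclideanSpace.single i 1))
    (hM.fderivWithin_comp_tangentProj hx hφ)

theorem IsSmoothHypersurface.tangentialGradient_eq {φ : Ambient n → ℝ} {L : Ambient n →L[ℝ] ℝ}
    {x : Ambient n} (hx : x ∈ M) (hφ : HasFDerivWithinAt φ L M x) :
    tangentialGradient M φ x =
      (InnerProductSpace.toDual ℝ (Ambient n)).symm (L ∘L tangentProj (unitNormal M x)) := by
  ext i
  have : inner ℝ ((InnerProductSpace.toDual ℝ (Ambient n)).symm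
      (L ∘L tangentProj (unitNormal M x))) (EuclideanSpace.single i (1 : ℝ)) =
      L (tangentProj (unitNormal M x) (EuclideanSpace.single i 1)) := by
    simp
  rw [EuclideanSpace.inner_single_right] at this
  simpa [tangentialGradient, hM.tangentialDeriv_eq hx hφ i] using this.symm

theorem IsSmoothHypersurface.tangentialDiv_eq {Z : Ambient n → Ambient n}
    {L : Ambient n →L[ℝ] Ambient n} {x : Ambient n} (hx : x ∈ M) (hZ : HasFDerivWithinAt Z L M x) :
    tangentialDiv M Z x = LinearMap.trace ℝ (Ambient n)
      (L ∘L tangentProj (unitNormal M x) : Ambient n →L[ℝ] Ambient n) := by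
  rw [LinearMap.trace_eq_sum_inner _ (EuclideanSpace.basisFun (Fin (n + 1)) ℝ), tangentialDiv]
  refine Finset.sum_congr rfl fun i _ => ?_
  have hi : HasFDerivWithinAt (fun y => Z y i) (EuclideanSpace.proj i ∘L L) M x :=
    (EuclideanSpace.proj (𝕜 := ℝ) i).hasFDerivAt.comp_hasFDerivWithinAt x hZ
  rw [hM.tangentialDeriv_eq hx hi]
  simp [EuclideanSpace.inner_single_left]

theorem Graph.IsChartOn.tangentialDiv_param {Γ : Graph n} {W : Set (Ambient n)}
    (h : Γ.IsChartOn M W) {y : Base n} (hy : Γ.param y ∈ W) {Z : Ambient n → Ambient n}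
    (hZ : DifferentiableWithinAt ℝ Z M (Γ.param y)) :
    tangentialDiv M Z (Γ.param y) = Γ.div (fun z => Z (Γ.param z)) y := by
  rw [hM.tangentialDiv_eq (h.param_mem hy) hZ.hasFDerivWithinAt, h.tangentProj_unitNormal hM hy,
    Graph.div, h.fderiv_comp_proj hy hZ.hasFDerivWithinAt]

/-- The same `s` serves `ν` and `H`, but it may jump from point to point. So `H ν`, `H²` and squares
of components of `ν` are regular, although `ν` and `H` themselves need not be. -/
theorem Graph.IsChartOn.exists_sign_meanCurvature {Γ : Graph n} {W : Set (Ambient n)}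
    (h : Γ.IsChartOn M W) {y : Base n} (hy : Γ.param y ∈ W) :
    ∃ s : ℝ, s ^ 2 = 1 ∧ unitNormal M (Γ.param y) = s • Γ.normal y ∧
      meanCurvature M (Γ.param y) = s * Γ.div Γ.normal y := by
  obtain ⟨s, hs, h1, h2⟩ := h.exists_sign_unitNormal hM hy
  refine ⟨s, hs, h1, ?_⟩
  have hx := h.param_mem hy
  have hN : HasFDerivAt (fun x => Γ.normal (Γ.proj x)) (fderiv ℝ Γ.normal y ∘L Γ.proj)
      (Γ.param y) := by
    have : HasFDerivAt Γ.normal (fderiv ℝ Γ.normal y) (Γ.proj (Γ.param y)) := by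
      rw [Γ.proj_param]
      exact (Γ.contDiff_normal.differentiable (by simp) y).hasFDerivAt
    exact this.comp _ Γ.proj.hasFDerivAt
  have hN' : HasFDerivWithinAt (localUnitNormal M (Γ.param y))
      (s • (fderiv ℝ Γ.normal y ∘L Γ.proj)) M (Γ.param y) :=
    (hN.const_smul s).hasFDerivWithinAt.congr_of_eventuallyEq h2 (h2.eq_of_nhdsWithin hx)
  rw [meanCurvature, hM.tangentialDiv_eq hx hN', h.tangentProj_unitNormal hM hy, Graph.div]
  simp

end TangentialCalculus

/-! ### Integration on `M` and the divergence theorem. -/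

section Integration

/-- Integration by parts against the constant function `1`. -/
theorem integral_fderiv_eq_zero {V F : Type*} [NormedAddCommGroup V] [NormedSpace ℝ V]
    [FiniteDimensional ℝ V] [MeasurableSpace V] [BorelSpace V] [NormedAddCommGroup F]
    [NormedSpace ℝ F] [CompleteSpace F] (μ : Measure V) [μ.IsAddHaarMeasure] {w : V → F}
    (hw : ContDiff ℝ 1 w) (hc : HasCompactSupport w) : ∫ y, fderiv ℝ w y ∂μ = 0 := by
  have hint : Integrable (fderiv ℝ w) μ :=
    (hw.continuous_fderiv (by simp)).integrable_of_hasCompactSupport (hc.fderiv ℝ)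
  ext v
  rw [ContinuousLinearMap.integral_apply hint]
  have := integral_smul_fderiv_eq_neg_fderiv_smul_of_integrable (μ := μ) (f := fun _ => (1 : ℝ))
    (g := w) (v := v) (by simp) (by simpa using hint.apply_continuousLinearMap v)
    (by simpa using hw.continuous.integrable_of_hasCompactSupport hc) (by simp)
    (fun x _ => hw.differentiable (by simp) x)
  simpa using this

variable {M : Set (Ambient n)} (hM : IsSmoothHypersurface M)
include hM

theorem IsSmoothHypersurface.tangentialDiv_eq_zero {K : Set (Ambient n)} (hK : IsClosed K)
    {Z : Ambient n → Ambient n} (hZK : ∀ x ∉ K, Z x = 0) {x : Ambient n} (hx : x ∈ M \ K) :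
    tangentialDiv M Z x = 0 := by
  have h0 : HasFDerivWithinAt Z (0 : Ambient n →L[ℝ] Ambient n) M x := by
    refine (hasFDerivWithinAt_const (0 : Ambient n) x M).congr_of_eventuallyEq ?_ (hZK x hx.2)
    filter_upwards [mem_nhdsWithin_of_mem_nhds (hK.isOpen_compl.mem_nhds hx.2)]
      with z hz using hZK z hz
  rw [hM.tangentialDiv_eq hx.1 h0]
  simp

/-- The graph may leave `M` outside `W`, where `q` is uncontrolled; hence the indicator of `K`. -/
theorem Graph.IsChartOn.setIntegral_eq {Γ : Graph n} {W K : Set (Ambient n)}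
    (h : Γ.IsChartOn M W) (hK : IsCompact K) (hKM : K ⊆ M ∩ W) {q : Ambient n → ℝ}
    (hq : ∀ x ∈ M \ K, q x = 0) :
    ∫ x in M, q x ∂(μHE[n] : Measure (Ambient n)) =
      ∫ y, Γ.jac y * K.indicator q (Γ.param y) := by
  have hKS : K ⊆ Γ.surface := fun x hx => (h.2.subset (hKM hx)).1
  rw [← Γ.setIntegral_surface, setIntegral_indicator hK.measurableSet,
    Set.inter_eq_self_of_subset_right hKS]
  exact setIntegral_eq_of_subset_of_forall_sdiff_eq_zero hM.measurableSet
    (fun x hx => (hKM hx).1) hq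

/-- Pulled back with its density, the integrand is the Euclidean divergence of the compactly
supported `C¹` field `w`, written as a trace through `proj`. -/
theorem Graph.IsChartOn.integral_tangentialDiv_sub {Γ : Graph n} {W K : Set (Ambient n)}
    (h : Γ.IsChartOn M W) (hK : IsCompact K) (hKM : K ⊆ M ∩ W) {Z : Ambient n → Ambient n}
    (hZ : ContDiffOn ℝ 1 Z M) (hZK : ∀ x ∉ K, Z x = 0) :
    ∫ x in M, (tangentialDiv M Z x - meanCurvature M x * inner ℝ (unitNormal M x) (Z x))
      ∂(μHE[n] : Measure (Ambient n)) = 0 := by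
  have hdiff : DifferentiableOn ℝ Z M := hZ.differentiableOn (by simp)
  have hq : ∀ x ∈ M \ K,
      tangentialDiv M Z x - meanCurvature M x * inner ℝ (unitNormal M x) (Z x) = 0 := by
    intro x hx
    rw [hM.tangentialDiv_eq_zero hK.isClosed hZK hx, hZK x hx.2]
    simp
  rw [h.setIntegral_eq hM hK hKM hq]
  set Zp : Base n → Ambient n := fun y => Z (Γ.param y)
  set w : Base n → Ambient n :=
    fun z => Γ.jac z • (Zp z - inner ℝ (Γ.normal z) (Zp z) • Γ.normal z)
  have hKp := Γ.isCompact_preimage_param hK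
  have hZp : ∀ y ∉ Γ.param ⁻¹' K, Zp y = 0 := fun y hy => hZK _ hy
  have hw0 : ∀ y ∉ Γ.param ⁻¹' K, w y = 0 := fun y hy => by simp [w, hZp y hy]
  have hw0' : ∀ y ∉ Γ.param ⁻¹' K, w =ᶠ[𝓝 y] fun _ => 0 := fun y hy => by
    filter_upwards [hKp.isClosed.isOpen_compl.mem_nhds hy] with z hz using hw0 z hz
  have hZpW : ContDiffOn ℝ 1 Zp (Γ.param ⁻¹' W) := h.contDiffOn_comp hZ
  have hw : ContDiff ℝ 1 w := by
    rw [contDiff_iff_contDiffAt]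
    intro y
    by_cases hy : Γ.param y ∈ K
    · have h1 : ContDiffAt ℝ 1 Zp y :=
        hZpW.contDiffAt (h.isOpen_preimage.mem_nhds (hKM hy).2)
      have h2 : ContDiffAt ℝ 1 Γ.normal y := (Γ.contDiff_normal.of_le (by simp)).contDiffAt
      have h3 : ContDiffAt ℝ 1 Γ.jac y := (Γ.contDiff_jac.of_le (by simp)).contDiffAt
      exact h3.smul (h1.sub ((h2.inner ℝ h1).smul h2))
    · exact contDiffAt_const.congr_of_eventuallyEq (hw0' y hy)
  have hwc : HasCompactSupport w := HasCompactSupport.intro hKp hw0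
  have hint : Integrable (fderiv ℝ w) :=
    (hw.continuous_fderiv (by simp)).integrable_of_hasCompactSupport (hwc.fderiv ℝ)
  have key : ∀ y, Γ.jac y * K.indicator (fun x => tangentialDiv M Z x -
      meanCurvature M x * inner ℝ (unitNormal M x) (Z x)) (Γ.param y) =
      LinearMap.trace ℝ (Ambient n) (fderiv ℝ w y ∘L Γ.proj : Ambient n →L[ℝ] Ambient n) := by
    intro y
    by_cases hy : Γ.param y ∈ K
    · have hyW := (hKM hy).2
      have hyM := (hKM hy).1
      have h1 : DifferentiableAt ℝ Zp y :=
        (h.hasFDerivAt_comp hyW (hdiff _ hyM).hasFDerivWithinAt).differentiableAt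
      obtain ⟨s, hs, hν, hH⟩ := h.exists_sign_meanCurvature hM hyW
      rw [Γ.trace_fderiv_jac_smul_tangential h1, Set.indicator_of_mem hy,
        h.tangentialDiv_param hM hyW (hdiff _ hyM), hν, hH, inner_smul_left]
      simp only [conj_trivial]
      linear_combination (-(Γ.jac y) * Γ.div Γ.normal y * inner ℝ (Γ.normal y) (Zp y)) * hs
    · rw [Set.indicator_of_notMem hy, (hw0' y hy).fderiv_eq]
      simp
  simp_rw [key]
  let tr : (Base n →L[ℝ] Ambient n) →L[ℝ] ℝ := LinearMap.toContinuousLinearMap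
    (LinearMap.trace ℝ (Ambient n) ∘ₗ ContinuousLinearMap.coeLM ℝ ∘ₗ
      ((ContinuousLinearMap.compL ℝ (Ambient n) (Base n) (Ambient n)).flip Γ.proj).toLinearMap)
  calc _ = ∫ y, tr (fderiv ℝ w y) := rfl
    _ = tr (∫ y, fderiv ℝ w y) := tr.integral_comp_comm hint
    _ = 0 := by rw [integral_fderiv_eq_zero _ hw hwc, map_zero]

omit hM in
theorem Graph.IsChartOn.continuousOn_fderiv_comp {Γ : Graph n} {W : Set (Ambient n)}
    (h : Γ.IsChartOn M W) {F : Type*} [NormedAddCommGroup F] [NormedSpace ℝ F]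
    {Z : Ambient n → F} (hZ : ContDiffOn ℝ 1 Z M) :
    ContinuousOn (fun y => (fderiv ℝ (fun z => Z (Γ.param z)) y ∘L Γ.proj) ∘L
      tangentProj (Γ.normal y)) (Γ.param ⁻¹' W) :=
  (((h.contDiffOn_comp hZ).continuousOn_fderiv_of_isOpen h.isOpen_preimage (by simp)).clm_comp
    continuousOn_const).clm_comp
    (continuous_tangentProj.comp Γ.contDiff_normal.continuous).continuousOn

omit hM in
theorem Graph.continuous_div_normal (Γ : Graph n) : Continuous (Γ.div Γ.normal) := by
  refine continuous_trace.comp (((Γ.contDiff_normal.continuous_fderiv (by simp)).clm_comp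
    continuous_const).clm_comp (continuous_tangentProj.comp Γ.contDiff_normal.continuous))

theorem IsSmoothHypersurface.continuousOn_tangentialDiv {Z : Ambient n → Ambient n}
    (hZ : ContDiffOn ℝ 1 Z M) : ContinuousOn (tangentialDiv M Z) M := by
  refine hM.continuousOn_of_graph fun Γ W h => ?_
  refine (continuous_trace.comp_continuousOn (h.continuousOn_fderiv_comp hZ)).congr
    fun y hy => ?_
  rw [h.tangentialDiv_param hM hy (hZ.differentiableOn (by simp) _ (h.param_mem hy))]
  rfl

theorem IsSmoothHypersurface.continuousOn_tangentialGradient {φ : Ambient n → ℝ}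
    (hφ : ContDiffOn ℝ 1 φ M) : ContinuousOn (tangentialGradient M φ) M := by
  refine hM.continuousOn_of_graph fun Γ W h => ?_
  refine ((InnerProductSpace.toDual ℝ (Ambient n)).symm.continuous.comp_continuousOn
    (h.continuousOn_fderiv_comp hφ)).congr fun y hy => ?_
  have hd := (hφ.differentiableOn (by simp) _ (h.param_mem hy)).hasFDerivWithinAt
  rw [hM.tangentialGradient_eq (h.param_mem hy) hd, h.tangentProj_unitNormal hM hy,
    ← h.fderiv_comp_proj hy hd]
  rfl

theorem IsSmoothHypersurface.continuousOn_meanCurvature_mul_inner {Z : Ambient n → Ambient n}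
    (hZ : ContinuousOn Z M) :
    ContinuousOn (fun x => meanCurvature M x * inner ℝ (unitNormal M x) (Z x)) M := by
  refine hM.continuousOn_of_graph fun Γ W h => ?_
  have hZ' : ContinuousOn (fun y => Z (Γ.param y)) (Γ.param ⁻¹' W) :=
    hZ.comp Γ.continuous_param.continuousOn fun y hy => h.param_mem hy
  refine (Γ.continuous_div_normal.continuousOn.mul
    (Γ.contDiff_normal.continuous.continuousOn.inner hZ')).congr fun y hy => ?_
  obtain ⟨s, hs, hν, hH⟩ := h.exists_sign_meanCurvature hM hy
  simp only [hν, hH, inner_smul_left, conj_trivial, Pi.mul_apply]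
  linear_combination (Γ.div Γ.normal y * inner ℝ (Γ.normal y) (Z (Γ.param y))) * hs

theorem IsSmoothHypersurface.continuousOn_meanCurvature_sq :
    ContinuousOn (fun x => meanCurvature M x ^ 2) M := by
  refine hM.continuousOn_of_graph fun Γ W h => ?_
  refine (Γ.continuous_div_normal.pow 2).continuousOn.congr fun y hy => ?_
  obtain ⟨s, hs, hν, hH⟩ := h.exists_sign_meanCurvature hM hy
  simp only [hH, Pi.pow_apply]
  linear_combination (Γ.div Γ.normal y ^ 2) * hs

theorem IsSmoothHypersurface.continuousOn_inner_unitNormal_sq {Z : Ambient n → Ambient n}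
    (hZ : ContinuousOn Z M) : ContinuousOn (fun x => inner ℝ (Z x) (unitNormal M x) ^ 2) M := by
  refine hM.continuousOn_of_graph fun Γ W h => ?_
  have hZ' : ContinuousOn (fun y => Z (Γ.param y)) (Γ.param ⁻¹' W) :=
    hZ.comp Γ.continuous_param.continuousOn fun y hy => h.param_mem hy
  refine ((hZ'.inner Γ.contDiff_normal.continuous.continuousOn).pow 2).congr fun y hy => ?_
  obtain ⟨s, hs, hν, hH⟩ := h.exists_sign_meanCurvature hM hy
  simp only [hν, inner_smul_right, Pi.pow_apply]
  linear_combination (inner ℝ (Z (Γ.param y)) (Γ.normal y) ^ 2) * hs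

omit hM in
-- For `b > 0` the integrand is at most `|y|^{-b}`, locally integrable on `ℝ^n` since `b < n`; for
-- `b ≤ 0` it is continuous.
theorem Graph.integrableOn_norm_param_rpow (Γ : Graph n) {b : ℝ} (hb : b < n) {K : Set (Base n)}
    (hK : IsCompact K) : IntegrableOn (fun y => ‖Γ.param y‖ ^ (-b)) K := by
  rcases le_or_gt b 0 with hb0 | hb0
  · exact ContinuousOn.integrableOn_compact hK
      (Γ.continuous_param.norm.rpow_const fun y => Or.inr (by linarith)).continuousOn
  obtain ⟨R, hR⟩ := hK.isBounded.subset_ball (0 : Base n)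
  refine IntegrableOn.mono_set ?_ hR
  have hn : 1 ≤ n := by
    by_contra hn
    have : n = 0 := by omega
    subst this
    simp at hb; linarith
  have : Nontrivial (Base n) := by
    apply Module.nontrivial_of_finrank_pos (R := ℝ)
    simp; omega
  refine integrableOn_ball_of_norm_le_rpow (C := 1) (α := b) (by simpa using hn) (by simpa using hb)
    ?_ ?_
  · have h0 : ∀ᵐ y : Base n, y ≠ 0 := Measure.ae_ne _ _
    filter_upwards [ae_restrict_of_ae h0] with y hy
    rw [one_mul, Real.norm_of_nonneg (by positivity)]
    exact Real.rpow_le_rpow_of_nonpos (norm_pos_iff.2 hy) (Γ.norm_le_norm_param y) (by linarith)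
  · exact (Γ.continuous_param.norm.measurable.pow_const _).aestronglyMeasurable

theorem IsSmoothHypersurface.locallyIntegrableOn_div_norm_rpow {q : Ambient n → ℝ}
    (hq : ContinuousOn q M) {b : ℝ} (hb : b < n) :
    LocallyIntegrableOn (fun x => q x / ‖x‖ ^ b) M (μHE[n] : Measure (Ambient n)) := by
  intro x hx
  obtain ⟨Γ, W, h, hxW⟩ := hM.exists_graph hx
  have hx' := h.param_proj ⟨hx, hxW⟩
  obtain ⟨r, hr, hrW⟩ := Metric.nhds_basis_closedBall.mem_iff.1
    (h.isOpen_preimage.mem_nhds (show Γ.proj x ∈ Γ.param ⁻¹' W by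
      rw [Set.mem_preimage, hx']; exact hxW))
  set B := Metric.closedBall (Γ.proj x) r
  have hBm : MeasurableSet (Γ.proj ⁻¹' B) :=
    (Metric.isClosed_closedBall.preimage Γ.proj.continuous).measurableSet
  have hBc : IsCompact B := isCompact_closedBall _ _
  refine ⟨Γ.surface ∩ Γ.proj ⁻¹' B, ?_, ?_⟩
  · filter_upwards [self_mem_nhdsWithin, mem_nhdsWithin_of_mem_nhds (h.1.mem_nhds hxW),
      mem_nhdsWithin_of_mem_nhds (Γ.proj.continuous.continuousAt.preimage_mem_nhds
        (Metric.closedBall_mem_nhds (Γ.proj x) hr))] with z h1 h2 h3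
    exact ⟨(h.2.subset ⟨h1, h2⟩).1, h3⟩
  · rw [Set.inter_comm, IntegrableOn, ← Measure.restrict_restrict hBm, ← IntegrableOn,
      ← integrable_indicator_iff hBm]
    refine Γ.integrableOn_surface_iff.2 ?_
    have e : (fun y => Γ.jac y * (Γ.proj ⁻¹' B).indicator (fun x => q x / ‖x‖ ^ b) (Γ.param y)) =
        B.indicator fun y => (Γ.jac y * q (Γ.param y)) * ‖Γ.param y‖ ^ (-b) := by
      ext y
      by_cases hy : y ∈ B
      · have : Γ.param y ∈ Γ.proj ⁻¹' B := by simpa using hy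
        rw [Set.indicator_of_mem hy, Set.indicator_of_mem this, Real.rpow_neg (norm_nonneg _)]
        ring
      · have : Γ.param y ∉ Γ.proj ⁻¹' B := by simpa using hy
        rw [Set.indicator_of_notMem hy, Set.indicator_of_notMem this, mul_zero]
    rw [e, integrable_indicator_iff hBc.measurableSet]
    refine (Γ.integrableOn_norm_param_rpow hb hBc).continuousOn_mul ?_ hBc
    exact Γ.contDiff_jac.continuous.continuousOn.mul
      (hq.comp Γ.continuous_param.continuousOn fun y hy => h.param_mem (hrW hy))

theorem IsSmoothHypersurface.integrable_div_norm_rpow {q : Ambient n → ℝ}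
    (hq : ContinuousOn q M) {K : Set (Ambient n)} (hK : IsCompact K) (hKM : K ⊆ M)
    (hqK : ∀ x ∈ M \ K, q x = 0) {b : ℝ} (hb : b < n) :
    Integrable (fun x => q x / ‖x‖ ^ b) (volumeMeasure M) :=
  ((hM.locallyIntegrableOn_div_norm_rpow hq hb).integrableOn_compact_subset hKM
    hK).of_forall_sdiff_eq_zero hM.measurableSet fun x hx => by simp [hqK x hx]

theorem IsSmoothHypersurface.integrable_of_continuousOn (hn : 0 < n) {q : Ambient n → ℝ}
    (hq : ContinuousOn q M) {K : Set (Ambient n)} (hK : IsCompact K) (hKM : K ⊆ M)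
    (hqK : ∀ x ∈ M \ K, q x = 0) : Integrable q (volumeMeasure M) := by
  simpa using hM.integrable_div_norm_rpow hq hK hKM hqK (b := 0) (by exact_mod_cast hn)

/-- The divergence theorem on a hypersurface, for a compactly supported vector field which need not
be tangent. -/
theorem IsSmoothHypersurface.integral_tangentialDiv_sub (hn : 0 < n) {K : Set (Ambient n)}
    (hK : IsCompact K) (hKM : K ⊆ M) {Z : Ambient n → Ambient n} (hZ : ContDiffOn ℝ 1 Z M)
    (hZK : ∀ x ∉ K, Z x = 0) :
    ∫ x, (tangentialDiv M Z x - meanCurvature M x * inner ℝ (unitNormal M x) (Z x))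
      ∂(volumeMeasure M) = 0 := by
  choose! Γ W hΓ hW using fun p (hp : p ∈ M) => hM.exists_graph hp
  obtain ⟨t, htK, hKt⟩ := hK.elim_nhds_subcover W fun p hp =>
    (hΓ p (hKM hp)).1.mem_nhds (hW p (hKM hp))
  -- The partition of unity lives on the ambient space, so no manifold structure on `M` is needed.
  obtain ⟨f, hf⟩ := SmoothPartitionOfUnity.exists_isSubordinate
    (modelWithCornersSelf ℝ (Ambient n)) hK.isClosed (fun p : t => W p)
    (fun p => (hΓ p (hKM (htK p p.2))).1) (by simpa [Set.iUnion_subtype] using hKt)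
  have hfs : ∀ i, ContDiff ℝ 1 (f i) := fun i =>
    ((f i).contMDiff.contDiff).of_le (by simp)
  have hsum : ∀ x, ∑ i, f i x • Z x = Z x := by
    intro x
    by_cases hx : x ∈ K
    · rw [← Finset.sum_smul, ← finsum_eq_sum_of_fintype, f.sum_eq_one hx, one_smul]
    · simp [hZK x hx]
  have hZi : ∀ i, ContDiffOn ℝ 1 (fun x => f i x • Z x) M := fun i => (hfs i).contDiffOn.smul hZ
  have hZi0 : ∀ i, ∀ x ∉ K, f i x • Z x = 0 := fun i x hx => by simp [hZK x hx]
  have hloc : ∀ i, ∫ x, (tangentialDiv M (fun x => f i x • Z x) x -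
      meanCurvature M x * inner ℝ (unitNormal M x) (f i x • Z x)) ∂(volumeMeasure M) = 0 := by
    intro i
    refine (hΓ i (hKM (htK i i.2))).integral_tangentialDiv_sub hM
      (hK.inter_right (isClosed_tsupport (f i))) (fun x hx => ⟨hKM hx.1, hf i hx.2⟩) (hZi i)
      fun x hx => ?_
    by_cases hxK : x ∈ K
    · have : f i x = 0 := image_eq_zero_of_notMem_tsupport fun h => hx ⟨hxK, h⟩
      simp [this]
    · exact hZi0 i x hxK
  have hint : ∀ i, Integrable (fun x => tangentialDiv M (fun x => f i x • Z x) x -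
      meanCurvature M x * inner ℝ (unitNormal M x) (f i x • Z x)) (volumeMeasure M) := by
    intro i
    refine hM.integrable_of_continuousOn hn ((hM.continuousOn_tangentialDiv (hZi i)).sub
      (hM.continuousOn_meanCurvature_mul_inner (hZi i).continuousOn)) hK hKM fun x hx => ?_
    rw [hM.tangentialDiv_eq_zero hK.isClosed (hZi0 i) hx, hZi0 i x hx.2]
    simp
  have hpt : ∀ x ∈ M, tangentialDiv M Z x - meanCurvature M x * inner ℝ (unitNormal M x) (Z x) =
      ∑ i, (tangentialDiv M (fun x => f i x • Z x) x -
        meanCurvature M x * inner ℝ (unitNormal M x) (f i x • Z x)) := by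
    intro x hx
    have hd : ∀ i, HasFDerivWithinAt (fun x => f i x • Z x)
        (fderivWithin ℝ (fun x => f i x • Z x) M x) M x := fun i =>
      ((hZi i).differentiableOn (by simp) x hx).hasFDerivWithinAt
    have hds := HasFDerivWithinAt.fun_sum (u := Finset.univ) fun i _ => hd i
    simp_rw [hsum] at hds
    have hds' : HasFDerivWithinAt Z _ M x := hds
    rw [hM.tangentialDiv_eq hx hds', Finset.sum_sub_distrib, ← Finset.mul_sum, ← inner_sum, hsum]
    congr 1
    rw [Finset.sum_congr rfl fun i _ => hM.tangentialDiv_eq hx (hd i), ← map_sum]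
    congr 1
    ext v
    simp
  rw [volumeMeasure, setIntegral_congr_fun hM.measurableSet hpt]
  exact (integral_finsetSum _ fun i _ => hint i).trans (Finset.sum_eq_zero fun i _ => hloc i)

end Integration

theorem volumeMeasure_singleton (hn : 0 < n) (M : Set (Ambient n)) (x : Ambient n) :
    volumeMeasure M {x} = 0 := by
  have := Measure.nullSingletonClass_hausdorff (Ambient n) (d := (n : ℝ)) (by exact_mod_cast hn)
  refine le_antisymm ((Measure.restrict_apply_le _ _).trans ?_) zero_le
  rw [Measure.euclideanHausdorffMeasure_def, Measure.smul_apply, measure_singleton, smul_zero]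

theorem IsC1c.exists_compact {M : Set (Ambient n)} {φ : Ambient n → ℝ} (hφ : IsC1c M φ) :
    ∃ K ⊆ M, IsCompact K ∧ ∀ x ∈ M \ K, φ x = 0 := by
  refine ⟨Subtype.val '' tsupport (M.domRestrict φ), by simp,
    hφ.2.isCompact.image continuous_subtype_val, fun x hx => ?_⟩
  by_contra h
  exact hx.2 ⟨⟨x, hx.1⟩, subset_tsupport _ h, rfl⟩

/-! ### Pointwise identities behind the inequality. -/

section PointwiseIdentities

variable {M : Set (Ambient n)} (hM : IsSmoothHypersurface M)
include hM

/-- Product rule, where `n` is the trace of the tangential projection of `ℝ^{n+1}`. -/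
theorem IsSmoothHypersurface.tangentialDiv_smul_id {u : Ambient n → ℝ} {L : Ambient n →L[ℝ] ℝ}
    {x : Ambient n} (hx : x ∈ M) (hu : HasFDerivWithinAt u L M x) :
    tangentialDiv M (fun z => u z • z) x = n * u x + L (tangentProj (unitNormal M x) x) := by
  have hZ := hu.smul (hasFDerivWithinAt_id x M)
  have hZ' : HasFDerivWithinAt (fun z => u z • z) _ M x := hZ
  rw [hM.tangentialDiv_eq hx hZ', ContinuousLinearMap.add_comp, ContinuousLinearMap.toLinearMap_add,
    map_add, ContinuousLinearMap.smul_comp, ContinuousLinearMap.toLinearMap_smul, map_smul,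
    trace_comp_tangentProj]
  have e : L.smulRight x ∘L tangentProj (unitNormal M x) = InnerProductSpace.rankOne ℝ x
      ((InnerProductSpace.toDual ℝ (Ambient n)).symm (L ∘L tangentProj (unitNormal M x))) := by
    ext1 v; simp
  rw [id, e, InnerProductSpace.trace_rankOne]
  simp [hM.norm_unitNormal hx]
  ring

/-- Orthogonality of `ν` and `∇_T φ`. With `s = Hφ` this lets one application of Cauchy–Schwarz
treat curvature and gradient together. -/
theorem IsSmoothHypersurface.norm_sq_smul_unitNormal_sub {φ : Ambient n → ℝ}
    {x : Ambient n} (hx : x ∈ M) (hφ : DifferentiableWithinAt ℝ φ M x) (s : ℝ) :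
    ‖s • unitNormal M x - (2 : ℝ) • tangentialGradient M φ x‖ ^ 2 =
      4 * ‖tangentialGradient M φ x‖ ^ 2 + |s| ^ 2 := by
  have h0 : inner ℝ (unitNormal M x) (tangentialGradient M φ x) = 0 := by
    rw [hM.tangentialGradient_eq hx hφ.hasFDerivWithinAt, real_inner_comm,
      InnerProductSpace.toDual_symm_apply]
    simp [tangentProj_apply, hM.norm_unitNormal hx]
  rw [norm_sub_sq_real, inner_smul_left, inner_smul_right, h0, norm_smul, norm_smul,
    hM.norm_unitNormal hx]
  simp
  ring

omit hM in
theorem tangentialGradient_congr {φ ψ : Ambient n → ℝ} (h : Set.EqOn φ ψ M)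
    {x : Ambient n} (hx : x ∈ M) : tangentialGradient M φ x = tangentialGradient M ψ x := by
  ext i
  simp only [tangentialGradient, tangentialDeriv_eq_fderivWithin,
    fderivWithin_congr h (h hx)]

theorem IsSmoothHypersurface.tangentialGradient_eq_zero {K : Set (Ambient n)} (hK : IsClosed K)
    {φ : Ambient n → ℝ} (hφK : ∀ x ∉ K, φ x = 0) {x : Ambient n} (hx : x ∈ M \ K) :
    tangentialGradient M φ x = 0 := by
  have h0 : HasFDerivWithinAt φ (0 : Ambient n →L[ℝ] ℝ) M x := by
    refine (hasFDerivWithinAt_const (0 : ℝ) x M).congr_of_eventuallyEq ?_ (hφK x hx.2)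
    filter_upwards [mem_nhdsWithin_of_mem_nhds (hK.isOpen_compl.mem_nhds hx.2)]
      with z hz using hφK z hz
  rw [hM.tangentialGradient_eq hx.1 h0]
  simp

end PointwiseIdentities

/-! ### The regularized weight. -/

/-- The regularization `(|x|² + ε)^{-a/2}` of `|x|^{-a}`. -/
def regWeight (a ε : ℝ) (x : Ambient n) : ℝ := (‖x‖ ^ 2 + ε) ^ (-a / 2)

section RegWeight

variable {a ε : ℝ} (hε : 0 < ε)
include hε

theorem regWeight_nonneg (x : Ambient n) : 0 ≤ regWeight a ε x := by
  unfold regWeight; positivity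

theorem contDiff_regWeight : ContDiff ℝ 1 (regWeight a ε : Ambient n → ℝ) :=
  ((contDiff_norm_sq ℝ).add contDiff_const).rpow_const_of_ne fun x => by positivity

theorem fderiv_regWeight (x v : Ambient n) :
    fderiv ℝ (regWeight a ε) x v = -a * (regWeight a ε x / (‖x‖ ^ 2 + ε)) * inner ℝ x v := by
  have hpos : 0 < ‖x‖ ^ 2 + ε := by positivity
  have h1 : HasFDerivAt (fun z : Ambient n => ‖z‖ ^ 2 + ε) (2 • innerSL ℝ x) x :=
    (hasStrictFDerivAt_norm_sq x).hasFDerivAt.add_const ε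
  have h2 : HasFDerivAt (regWeight a ε) _ x := h1.rpow_const (p := -a / 2) (Or.inl hpos.ne')
  rw [h2.fderiv, Real.rpow_sub_one hpos.ne', regWeight]
  simp
  ring

theorem regWeight_le (ha : 0 ≤ a) {x : Ambient n} (hx : x ≠ 0) :
    regWeight a ε x ≤ (‖x‖ ^ a)⁻¹ := by
  have hx' : 0 < ‖x‖ := norm_pos_iff.2 hx
  have h : (‖x‖ ^ a)⁻¹ = (‖x‖ ^ 2) ^ (-a / 2) := by
    rw [← Real.rpow_neg hx'.le, ← Real.rpow_natCast, ← Real.rpow_mul hx'.le]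
    congr 1; push_cast; ring
  rw [h]
  exact Real.rpow_le_rpow_of_nonpos (by positivity) (by linarith) (by linarith)

omit hε in
theorem tendsto_regWeight {x : Ambient n} (hx : x ≠ 0) :
    Filter.Tendsto (fun ε => regWeight a ε x) (𝓝[>] 0) (𝓝 (‖x‖ ^ a)⁻¹) := by
  have hx' : 0 < ‖x‖ := norm_pos_iff.2 hx
  have h : (‖x‖ ^ a)⁻¹ = (‖x‖ ^ 2 + 0) ^ (-a / 2) := by
    rw [add_zero, ← Real.rpow_neg hx'.le, ← Real.rpow_natCast, ← Real.rpow_mul hx'.le]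
    congr 1; push_cast; ring
  rw [h]
  refine Filter.Tendsto.mono_left ?_ nhdsWithin_le_nhds
  have : ContinuousAt (fun ε : ℝ => (‖x‖ ^ 2 + ε) ^ (-a / 2)) 0 :=
    (continuousAt_const.add continuousAt_id).rpow_const (Or.inl (by simp; exact hx))
  exact this

end RegWeight

/-- The square of the cosine of the angle between the position vector and the normal. -/
def cosSq (M : Set (Ambient n)) (x : Ambient n) : ℝ :=
  inner ℝ (‖x‖⁻¹ • x) (unitNormal M x) ^ 2

theorem cosSq_eq (M : Set (Ambient n)) (x : Ambient n) :
    cosSq M x = (‖x‖⁻¹) ^ 2 * inner ℝ x (unitNormal M x) ^ 2 := by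
  rw [cosSq, inner_smul_left]; simp; ring

theorem cosSq_nonneg (M : Set (Ambient n)) (x : Ambient n) : 0 ≤ cosSq M x := sq_nonneg _

/-! ### The weighted inequality. -/

section Inequality

variable {M : Set (Ambient n)} (hM : IsSmoothHypersurface M)
include hM

theorem IsSmoothHypersurface.cosSq_le_one {x : Ambient n} (hx : x ∈ M) : cosSq M x ≤ 1 := by
  rw [cosSq, sq_le_one_iff_abs_le_one]
  refine (abs_real_inner_le_norm _ _).trans ?_
  rw [hM.norm_unitNormal hx, mul_one, norm_smul, norm_inv, norm_norm]
  exact inv_mul_le_one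

theorem IsSmoothHypersurface.aestronglyMeasurable_cosSq :
    AEStronglyMeasurable (cosSq M) (volumeMeasure M) := by
  have h1 := (hM.continuousOn_inner_unitNormal_sq continuousOn_id).aestronglyMeasurable
    (μ := (μHE[n] : Measure (Ambient n))) hM.measurableSet
  have h2 : AEStronglyMeasurable (fun x : Ambient n => (‖x‖⁻¹) ^ 2) (volumeMeasure M) :=
    (measurable_norm.inv.pow_const 2).aestronglyMeasurable
  exact (h2.mul h1).congr (Filter.Eventually.of_forall fun x => (cosSq_eq M x).symm)

variable {φ : Ambient n → ℝ} (hφ : ContDiffOn ℝ 1 φ M)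
include hφ

/-- The pointwise form of the inequality, for the divergence of the regularized vector field. -/
theorem IsSmoothHypersurface.le_tangentialDiv_add {a ε : ℝ} (ha : 0 ≤ a) (hε : 0 < ε)
    {x : Ambient n} (hx : x ∈ M) :
    φ x ^ 2 * regWeight a ε x * (n - a + a * cosSq M x) ≤
      (tangentialDiv M (fun z => (φ z ^ 2 * regWeight a ε z) • z) x -
        meanCurvature M x * inner ℝ (unitNormal M x) ((φ x ^ 2 * regWeight a ε x) • x)) +
      |φ x| / ‖x‖ ^ (a / 2) * (√(4 * ‖tangentialGradient M φ x‖ ^ 2 +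
        |meanCurvature M x * φ x| ^ 2) / ‖x‖ ^ ((a - 2) / 2)) := by
  set w := regWeight a ε x
  set H := meanCurvature M x
  set ν := unitNormal M x
  set D := tangentialGradient M φ x
  set B := √(4 * ‖D‖ ^ 2 + |H * φ x| ^ 2)
  have hν : ‖ν‖ = 1 := hM.norm_unitNormal hx
  have hd : DifferentiableWithinAt ℝ φ M x := hφ.differentiableOn (by simp) x hx
  have hw : DifferentiableAt ℝ (regWeight a ε) x :=
    (contDiff_regWeight hε).differentiable (by simp) x
  have hw0 : 0 ≤ w := regWeight_nonneg hε x
  have hu := (hd.hasFDerivWithinAt.pow 2).mul (hw.hasFDerivAt.hasFDerivWithinAt (s := M))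
  have hu' : HasFDerivWithinAt (fun z => φ z ^ 2 * regWeight a ε z) _ M x := hu
  have hD : fderivWithin ℝ φ M x (tangentProj ν x) = inner ℝ D x := by
    rw [show D = _ from hM.tangentialGradient_eq hx hd.hasFDerivWithinAt]
    simp [ν]
  have hxPx : inner ℝ x (tangentProj ν x) = ‖x‖ ^ 2 - inner ℝ x ν ^ 2 := by
    rw [tangentProj_apply, inner_sub_right, inner_smul_right, real_inner_comm x ν]
    simp; ring
  have hdiv : tangentialDiv M (fun z => (φ z ^ 2 * regWeight a ε z) • z) x =
      n * (φ x ^ 2 * w) + 2 * φ x * w * inner ℝ D x -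
        a * φ x ^ 2 * (w / (‖x‖ ^ 2 + ε)) * (‖x‖ ^ 2 - inner ℝ x ν ^ 2) := by
    rw [hM.tangentialDiv_smul_id hx hu']
    simp [hD, fderiv_regWeight hε, hxPx, w, ν]
    ring
  rw [hdiv, inner_smul_right]
  -- At the origin `cosSq` is `0` by convention and the last term is nonnegative whatever `0 ^ ·`
  -- means, so the claim reduces to `n - a ≤ n`.
  rcases eq_or_ne x 0 with rfl | hx0
  · have hc : cosSq M (0 : Ambient n) = 0 := by simp [cosSq]
    have : 0 ≤ |φ 0| / ‖(0 : Ambient n)‖ ^ (a / 2) * (B / ‖(0 : Ambient n)‖ ^ ((a - 2) / 2)) := by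
      positivity
    rw [hc]
    simp only [inner_zero_right, inner_zero_left]
    simp only [norm_zero] at this ⊢
    have h2 : 0 ≤ a * (φ 0 ^ 2 * w) := by positivity
    nlinarith
  have hxp : 0 < ‖x‖ := norm_pos_iff.2 hx0
  have hc : inner ℝ x ν ^ 2 = ‖x‖ ^ 2 * cosSq M x := by
    rw [cosSq_eq]; field_simp; rfl
  have hc1 := hM.cosSq_le_one hx
  -- The only loss due to `ε`. It multiplies `-a φ² (1 - cosSq)`, which is nonpositive, so it helps.
  have hfrac : w / (‖x‖ ^ 2 + ε) * ‖x‖ ^ 2 ≤ w := by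
    rw [div_mul_eq_mul_div, div_le_iff₀ (by positivity)]
    nlinarith
  have hCS : |H * φ x * inner ℝ ν x - 2 * inner ℝ D x| ≤ B * ‖x‖ := by
    have h1 : H * φ x * inner ℝ ν x - 2 * inner ℝ D x =
        inner ℝ ((H * φ x) • ν - (2 : ℝ) • D) x := by
      rw [inner_sub_left, inner_smul_left, inner_smul_left]; simp
    have h2 : B = ‖(H * φ x) • ν - (2 : ℝ) • D‖ := by
      rw [← Real.sqrt_sq (norm_nonneg _), hM.norm_sq_smul_unitNormal_sub hx hd]
    rw [h1, h2]
    exact abs_real_inner_le_norm _ _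
  have hB : |φ x| / ‖x‖ ^ (a / 2) * (B / ‖x‖ ^ ((a - 2) / 2)) =
      |φ x| * (‖x‖ ^ a)⁻¹ * (B * ‖x‖) := by
    have e : ‖x‖ ^ (a / 2) * ‖x‖ ^ ((a - 2) / 2) * ‖x‖ = ‖x‖ ^ a := by
      rw [← Real.rpow_add hxp, ← Real.rpow_add_one hxp.ne']
      congr 1; ring
    rw [div_mul_div_comm, ← e]
    field_simp
  have hterm : φ x * w * (H * φ x * inner ℝ ν x - 2 * inner ℝ D x) ≤
      |φ x| * (‖x‖ ^ a)⁻¹ * (B * ‖x‖) := by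
    refine (le_abs_self _).trans ?_
    rw [abs_mul, abs_mul, abs_of_nonneg hw0]
    gcongr
    exact regWeight_le hε ha hx0
  rw [hB, hc]
  have hmain : a * φ x ^ 2 * (1 - cosSq M x) * (w / (‖x‖ ^ 2 + ε) * ‖x‖ ^ 2) ≤
      a * φ x ^ 2 * (1 - cosSq M x) * w := by
    have : 0 ≤ 1 - cosSq M x := by linarith
    gcongr
  nlinarith [hmain, hterm]

theorem IsSmoothHypersurface.hardy_inequality {a : ℝ} (ha : 0 ≤ a) (han : a < n)
    {K : Set (Ambient n)} (hK : IsCompact K) (hKM : K ⊆ M) (hφK : ∀ x ∉ K, φ x = 0) :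
    Integrable (fun x => φ x ^ 2 / ‖x‖ ^ a) (volumeMeasure M) ∧
    Integrable (fun x => cosSq M x * (φ x ^ 2 / ‖x‖ ^ a)) (volumeMeasure M) ∧
    Integrable (fun x => (4 * ‖tangentialGradient M φ x‖ ^ 2 +
      |meanCurvature M x * φ x| ^ 2) / ‖x‖ ^ (a - 2)) (volumeMeasure M) ∧
    (n - a) * (∫ x, φ x ^ 2 / ‖x‖ ^ a ∂(volumeMeasure M)) +
      a * (∫ x, cosSq M x * (φ x ^ 2 / ‖x‖ ^ a) ∂(volumeMeasure M)) ≤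
      (∫ x, φ x ^ 2 / ‖x‖ ^ a ∂(volumeMeasure M)) ^ (1 / 2 : ℝ) *
      (∫ x, (4 * ‖tangentialGradient M φ x‖ ^ 2 + |meanCurvature M x * φ x| ^ 2) / ‖x‖ ^ (a - 2)
        ∂(volumeMeasure M)) ^ (1 / 2 : ℝ) := by
  have hn : 0 < n := by
    have : (0 : ℝ) < n := ha.trans_lt han
    exact_mod_cast this
  set μ := volumeMeasure M
  set Q : Ambient n → ℝ := fun x => 4 * ‖tangentialGradient M φ x‖ ^ 2 +
    |meanCurvature M x * φ x| ^ 2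
  have hQ0 : ∀ x, 0 ≤ Q x := fun x => by positivity
  have hQc : ContinuousOn Q M := by
    have h2 := (hM.continuousOn_meanCurvature_sq).mul (hφ.continuousOn.pow 2)
    refine (((continuousOn_const (c := (4 : ℝ))).mul
      ((hM.continuousOn_tangentialGradient hφ).norm.pow 2)).add
      h2).congr fun x _ => ?_
    simp [Q, mul_pow]
  have hQK : ∀ x ∈ M \ K, Q x = 0 := fun x hx => by
    simp [Q, hM.tangentialGradient_eq_zero hK.isClosed hφK hx, hφK x hx.2]
  have hI1 : Integrable (fun x => φ x ^ 2 / ‖x‖ ^ a) μ :=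
    hM.integrable_div_norm_rpow (hφ.continuousOn.pow 2) hK hKM
      (fun x hx => by simp [hφK x hx.2]) han
  have hI3 : Integrable (fun x => Q x / ‖x‖ ^ (a - 2)) μ :=
    hM.integrable_div_norm_rpow hQc hK hKM hQK (by linarith)
  have haeM : ∀ᵐ x ∂μ, x ∈ M := ae_restrict_mem hM.measurableSet
  have hae0 : ∀ᵐ x ∂μ, x ≠ 0 := by
    rw [ae_iff]; simpa using volumeMeasure_singleton hn M 0
  have hcm : AEStronglyMeasurable (cosSq M) μ := hM.aestronglyMeasurable_cosSq
  have hI2 : Integrable (fun x => cosSq M x * (φ x ^ 2 / ‖x‖ ^ a)) μ := by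
    refine hI1.bdd_mul (c := 1) hcm ?_
    filter_upwards [haeM] with x hx
    rw [Real.norm_of_nonneg (cosSq_nonneg M x)]
    exact hM.cosSq_le_one hx
  refine ⟨hI1, hI2, hI3, ?_⟩
  have hnormm : ∀ b : ℝ, AEStronglyMeasurable (fun x : Ambient n => ‖x‖ ^ b) μ := fun b =>
    (measurable_norm.pow_const b).aestronglyMeasurable
  have hφm : AEStronglyMeasurable φ μ := hφ.continuousOn.aestronglyMeasurable hM.measurableSet
  -- The weight is split so that `f²` and `g²` are exactly the two integrands on the right-hand
  -- side.
  set f : Ambient n → ℝ := fun x => |φ x| / ‖x‖ ^ (a / 2)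
  set g : Ambient n → ℝ := fun x => √(Q x) / ‖x‖ ^ ((a - 2) / 2)
  have hhalf : ∀ (x : Ambient n) (b : ℝ), (‖x‖ ^ (b / 2)) ^ 2 = ‖x‖ ^ b := fun x b => by
    rw [← Real.rpow_natCast, ← Real.rpow_mul (norm_nonneg _)]
    congr 1; push_cast; ring
  have hf2 : ∀ x, f x ^ 2 = φ x ^ 2 / ‖x‖ ^ a := fun x => by simp [f, div_pow, hhalf]
  have hg2 : ∀ x, g x ^ 2 = Q x / ‖x‖ ^ (a - 2) := fun x => by
    simp [g, div_pow, hhalf, Real.sq_sqrt (hQ0 x)]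
  have hfm : AEStronglyMeasurable f μ :=
    ((hφ.continuousOn.abs.aestronglyMeasurable hM.measurableSet).aemeasurable.div
      (hnormm _).aemeasurable).aestronglyMeasurable
  have hgm : AEStronglyMeasurable g μ :=
    ((hQc.sqrt.aestronglyMeasurable hM.measurableSet).aemeasurable.div
      (hnormm _).aemeasurable).aestronglyMeasurable
  have hfL : MemLp f 2 μ := (memLp_two_iff_integrable_sq hfm).2 (by simpa only [hf2] using hI1)
  have hgL : MemLp g 2 μ := (memLp_two_iff_integrable_sq hgm).2 (by simpa only [hg2] using hI3)
  have hfg : Integrable (fun x => f x * g x) μ := hfL.integrable_mul hgL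
  have hCS : ∫ x, f x * g x ∂μ ≤ (∫ x, φ x ^ 2 / ‖x‖ ^ a ∂μ) ^ (1 / 2 : ℝ) *
      (∫ x, Q x / ‖x‖ ^ (a - 2) ∂μ) ^ (1 / 2 : ℝ) := by
    have := integral_mul_le_Lp_mul_Lq_of_nonneg (μ := μ) Real.HolderConjugate.two_two
      (f := f) (g := g) (Filter.Eventually.of_forall fun x => by positivity)
      (Filter.Eventually.of_forall fun x => by positivity) (by simpa using hfL) (by simpa using hgL)
    simpa only [Real.rpow_two, hf2, hg2] using this
  set A : ℝ → Ambient n → ℝ := fun ε x => φ x ^ 2 * regWeight a ε x * (n - a + a * cosSq M x)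
  set A₀ : Ambient n → ℝ := fun x => φ x ^ 2 * (‖x‖ ^ a)⁻¹ * (n - a + a * cosSq M x)
  have hA₀ : ∀ x, A₀ x = (n - a) * (φ x ^ 2 / ‖x‖ ^ a) + a * (cosSq M x * (φ x ^ 2 / ‖x‖ ^ a)) :=
    fun x => by simp only [A₀]; ring
  have hA₀int : Integrable A₀ μ :=
    ((hI1.const_mul (n - a : ℝ)).add (hI2.const_mul a)).congr
      (Filter.Eventually.of_forall fun x => (hA₀ x).symm)
  have hAm : ∀ ε > 0, AEStronglyMeasurable (A ε) μ := fun ε hε =>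
    ((hφm.pow 2).mul (contDiff_regWeight hε).continuous.aestronglyMeasurable).mul
      (aestronglyMeasurable_const.add (hcm.const_mul a))
  have hAle : ∀ ε > 0, ∀ᵐ x ∂μ, ‖A ε x‖ ≤ A₀ x := by
    intro ε hε
    filter_upwards [hae0] with x hx
    have h1 : 0 ≤ n - a + a * cosSq M x :=
      add_nonneg (by linarith) (mul_nonneg ha (cosSq_nonneg M x))
    have h2 := regWeight_nonneg (a := a) hε x
    rw [Real.norm_of_nonneg (by positivity)]
    simp only [A, A₀]
    gcongr
    exact regWeight_le hε ha hx
  have hAint : ∀ ε > 0, Integrable (A ε) μ := fun ε hε => hA₀int.mono' (hAm ε hε) (hAle ε hε)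
  -- The divergence terms integrate to zero, leaving a bound independent of `ε`.
  have hbound : ∀ ε > 0, ∫ x, A ε x ∂μ ≤ ∫ x, f x * g x ∂μ := by
    intro ε hε
    set Z : Ambient n → Ambient n := fun z => (φ z ^ 2 * regWeight a ε z) • z
    have hZ : ContDiffOn ℝ 1 Z M :=
      ((hφ.pow 2).mul (contDiff_regWeight hε).contDiffOn).smul contDiffOn_id
    have hZK : ∀ x ∉ K, Z x = 0 := fun x hx => by simp [Z, hφK x hx]
    have hdiv := hM.integral_tangentialDiv_sub hn hK hKM hZ hZK
    have hint : Integrable (fun x => tangentialDiv M Z x -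
        meanCurvature M x * inner ℝ (unitNormal M x) (Z x)) μ :=
      hM.integrable_of_continuousOn hn ((hM.continuousOn_tangentialDiv hZ).sub
        (hM.continuousOn_meanCurvature_mul_inner hZ.continuousOn)) hK hKM fun x hx => by
          rw [hM.tangentialDiv_eq_zero hK.isClosed hZK hx, hZK x hx.2]; simp
    calc ∫ x, A ε x ∂μ ≤ ∫ x, ((tangentialDiv M Z x -
          meanCurvature M x * inner ℝ (unitNormal M x) (Z x)) + f x * g x) ∂μ := by
          refine integral_mono_ae (hAint ε hε) (hint.add hfg) ?_
          filter_upwards [haeM] with x hx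
          exact hM.le_tangentialDiv_add hφ ha hε hx
      _ = ∫ x, f x * g x ∂μ := by rw [integral_add hint hfg, hdiv, zero_add]
  have hlim : Filter.Tendsto (fun ε => ∫ x, A ε x ∂μ) (𝓝[>] 0) (𝓝 (∫ x, A₀ x ∂μ)) := by
    refine tendsto_integral_filter_of_dominated_convergence A₀ ?_ ?_ hA₀int ?_
    · filter_upwards [self_mem_nhdsWithin] with ε hε using hAm ε hε
    · filter_upwards [self_mem_nhdsWithin] with ε hε using hAle ε hε
    · filter_upwards [hae0] with x hx
      exact (((tendsto_regWeight hx).const_mul _).mul_const _)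
  have hle : ∫ x, A₀ x ∂μ ≤ ∫ x, f x * g x ∂μ :=
    le_of_tendsto hlim (by filter_upwards [self_mem_nhdsWithin] with ε hε using hbound ε hε)
  simp only [hA₀] at hle
  rw [integral_add (hI1.const_mul _) (hI2.const_mul _), integral_const_mul,
    integral_const_mul] at hle
  exact hle.trans hCS

end Inequality

end Hypersurface

end

theorem theorem1p3 (n : ℕ) (M : Set (Hypersurface.Ambient n))
    (hM : Hypersurface.IsSmoothHypersurface M) (a : ℝ) (ha0 : 0 ≤ a) (han : a < n)
    (φ : Hypersurface.Ambient n → ℝ) (hφ : Hypersurface.IsC1c M φ) :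
    Integrable (fun x => φ x ^ 2 / ‖x‖ ^ a) (Hypersurface.volumeMeasure M) ∧
    Integrable (fun x => inner ℝ (‖x‖⁻¹ • x) (Hypersurface.unitNormal M x) ^ 2 *
      (φ x ^ 2 / ‖x‖ ^ a)) (Hypersurface.volumeMeasure M) ∧
    Integrable (fun x => (4 * ‖Hypersurface.tangentialGradient M φ x‖ ^ 2 +
      |Hypersurface.meanCurvature M x * φ x| ^ 2) / ‖x‖ ^ (a - 2))
      (Hypersurface.volumeMeasure M) ∧
    (n - a) * (∫ x, φ x ^ 2 / ‖x‖ ^ a ∂(Hypersurface.volumeMeasure M)) +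
      a * (∫ x, inner ℝ (‖x‖⁻¹ • x) (Hypersurface.unitNormal M x) ^ 2 *
        (φ x ^ 2 / ‖x‖ ^ a) ∂(Hypersurface.volumeMeasure M)) ≤
      (∫ x, φ x ^ 2 / ‖x‖ ^ a ∂(Hypersurface.volumeMeasure M)) ^ (1 / 2 : ℝ) *
      (∫ x, (4 * ‖Hypersurface.tangentialGradient M φ x‖ ^ 2 +
        |Hypersurface.meanCurvature M x * φ x| ^ 2) / ‖x‖ ^ (a - 2)
        ∂(Hypersurface.volumeMeasure M)) ^ (1 / 2 : ℝ) := by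
  obtain ⟨K, hKM, hK, hφK⟩ := hφ.exists_compact
  -- Off `M` the values of `φ` are arbitrary, whereas `hardy_inequality` needs vanishing everywhere
  -- off `K`. Cutting off by `K` changes nothing on `M`.
  have heq : Set.EqOn (K.indicator φ) φ M := fun x hx => by
    by_cases hxK : x ∈ K
    · exact Set.indicator_of_mem hxK φ
    · rw [Set.indicator_of_notMem hxK, hφK x ⟨hx, hxK⟩]
  have key := hM.hardy_inequality (hφ.1.congr heq) ha0 han hK hKM
    fun x hx => Set.indicator_of_notMem hx φ
  have hae : ∀ᵐ x ∂(Hypersurface.volumeMeasure M), x ∈ M := ae_restrict_mem hM.measurableSet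
  have e1 : (fun x => K.indicator φ x ^ 2 / ‖x‖ ^ a) =ᵐ[Hypersurface.volumeMeasure M]
      fun x => φ x ^ 2 / ‖x‖ ^ a := by
    filter_upwards [hae] with x hx
    rw [heq hx]
  have e2 : (fun x => Hypersurface.cosSq M x * (K.indicator φ x ^ 2 / ‖x‖ ^ a))
      =ᵐ[Hypersurface.volumeMeasure M]
      fun x => inner ℝ (‖x‖⁻¹ • x) (Hypersurface.unitNormal M x) ^ 2 *
        (φ x ^ 2 / ‖x‖ ^ a) := by
    filter_upwards [hae] with x hx
    rw [heq hx, Hypersurface.cosSq]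
  have e3 : (fun x => (4 * ‖Hypersurface.tangentialGradient M (K.indicator φ) x‖ ^ 2 +
      |Hypersurface.meanCurvature M x * K.indicator φ x| ^ 2) / ‖x‖ ^ (a - 2))
      =ᵐ[Hypersurface.volumeMeasure M]
      fun x => (4 * ‖Hypersurface.tangentialGradient M φ x‖ ^ 2 +
        |Hypersurface.meanCurvature M x * φ x| ^ 2) / ‖x‖ ^ (a - 2) := by
    filter_upwards [hae] with x hx
    rw [heq hx, Hypersurface.tangentialGradient_congr heq hx]
  rwa [integrable_congr e1, integrable_congr e2, integrable_congr e3, integral_congr_ae e1,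
    integral_congr_ae e2, integral_congr_ae e3] at key
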